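/- Let $\Omega\subset\mathbb R^d$, $d\in\{1,2,3\}$, be a bounded convex polyhedral domain (the non-empty interior of the convex hull of finitely many points), and let $\lambda_j$, $\varphi_j$ ($j\ge 1$) be the eigenvalues and $L^2(\Omega)$-orthonormal eigenfunctions $\varphi_j\in H^1_0(\Omega)$ of the Dirichlet Laplacian $-\Delta$ on $\Omega$. For $s\ge -1$ let $\dot H^s(\Omega)$ be the space of all $v\in H^{-1}(\Omega)=H^1_0(\Omega)'$ with $$\|v\|_{\dot H^s(\Omega)}^2=\sum_{j=1}^\infty\lambda_j^s\langle v,\varphi_j\rangle^2<\infty ,\qquad \|u\|_{L^2(0,t;\dot H^s(\Omega))}^2=\int_0^t\|u(\tau)\|_{\dot H^s(\Omega)}^2\,d\tau .$$ Let $T>0$, $m\ge 0$, $0<\alpha_i<\alpha<1$ and $b_i>0$ for $i=1,\dots,m$, and put $P(\partial_t)=\partial_t^\alpha+\sum_{i=1}^m b_i\,\partial_t^{\alpha_i}$. Here $\partial_t^\beta$, $0<\beta<1$, is the Caputo derivative of a function with zero initial data, in the weak sense: $\partial_t^\beta u=g$ on $(0,T)$ means that $u,g\in L^1(0,T;H^{-1}(\Omega))$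 and $$\frac1{\Gamma(1-\beta)}\int_0^t(t-\tau)^{-\beta}u(\tau)\,d\tau=\int_0^t g(\tau)\,d\tau\quad\text{for a.e. }t\in(0,T)$$ (for $u$ absolutely continuous with $u(0)=0$ this is $g(t)=\frac1{\Gamma(1-\beta)}\int_0^t(t-\tau)^{-\beta}u'(\tau)\,d\tau$). For $t>0$ and $\chi\in H^{-1}(\Omega)$ let $$\bar E(t)\chi=\sum_{j=1}^\infty t^{\alpha-1}E_{(\alpha,\alpha-\alpha_1,\dots,\alpha-\alpha_m),\alpha}\bigl(-\lambda_jt^\alpha,-b_1t^{\alpha-\alpha_1},\dots,-b_mt^{\alpha-\alpha_m}\bigr)\langle\chi,\varphi_j\rangle\varphi_j ,$$ where $$E_{(\beta_1,\dots,\beta_n),\beta}(z_1,\dots,z_n)=\sum_{k=0}^\infty\ \sum_{l_1+\dots+l_n=k}\frac{k!}{l_1!\cdots l_n!}\,\frac{\prod_{i=1}^n z_i^{l_i}}{\Gamma\bigl(\beta+\sum_{i=1}^n\beta_il_i\bigr)}$$ is the multinomial Mittag-Leffler function. Let $-1<q\le 1$. There is a constant $C$, which may depend on the data above but not on $f$ or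 $t$, such that for every $f\in L^2(0,T;\dot H^q(\Omega))$ the following holds. The function $$u(t)=\int_0^t\bar E(t-s)f(s)\,ds$$ is well defined for a.e. $t\in(0,T)$ (the series for $\bar E(t-s)f(s)$ converges in $H^{-1}(\Omega)$ for a.e. $s\in(0,t)$ and the integral converges as a Bochner integral in $H^{-1}(\Omega)$), $u\in L^2(0,T;\dot H^{q+2}(\Omega))$, $P(\partial_t)u$ exists on $(0,T)$ and belongs to $L^2(0,T;\dot H^q(\Omega))$, and for all $t\in(0,T]$ $$\|u\|_{L^2(0,t;\dot H^{q+2}(\Omega))}+\|P(\partial_t)u\|_{L^2(0,t;\dot H^q(\Omega))}\le C\,\|f\|_{L^2(0,t;\dot H^q(\Omega))} .$$ -/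

import Mathlib

open MeasureTheory Set
open scoped ENNReal NNReal ContDiff

namespace FracDiffusion

noncomputable section

/-- `Ω` is a bounded convex polygonal (polyhedral) domain: the non-empty interior of the convex
hull of finitely many points. -/
def IsConvexPolytopeDomain {d : ℕ} (Ω : Set (EuclideanSpace ℝ (Fin d))) : Prop :=
  Ω.Nonempty ∧
    ∃ S : Finset (EuclideanSpace ℝ (Fin d)), Ω = interior (convexHull ℝ (S : Set _))

/-- `L²(Ω)`, real valued. -/
abbrev L2 {d : ℕ} (Ω : Set (EuclideanSpace ℝ (Fin d))) : Type :=
  Lp ℝ 2 (volume.restrict Ω)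

/-- `L²(Ω; ℝᵈ)`. -/
abbrev L2Vec {d : ℕ} (Ω : Set (EuclideanSpace ℝ (Fin d))) : Type :=
  Lp (EuclideanSpace ℝ (Fin d)) 2 (volume.restrict Ω)

/-- The closure of `C_c^∞(Ω)` in the `H¹` norm. An element is stored as the pair `(w, ∇w)` in
`L²(Ω) × L²(Ω; ℝᵈ)`. -/
def H10Sub {d : ℕ} (Ω : Set (EuclideanSpace ℝ (Fin d))) :
    Submodule ℝ (WithLp 2 (L2 Ω × L2Vec Ω)) :=
  (Submodule.span ℝ {p : WithLp 2 (L2 Ω × L2Vec Ω) |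
    ∃ ψ : EuclideanSpace ℝ (Fin d) → ℝ,
      ContDiff ℝ ∞ ψ ∧ HasCompactSupport ψ ∧ tsupport ψ ⊆ Ω ∧
      p.fst =ᵐ[volume.restrict Ω] ψ ∧
      p.snd =ᵐ[volume.restrict Ω] gradient ψ}).topologicalClosure

/-- `H¹₀(Ω)` with the `H¹` inner product `(v, w)_{L²} + (∇v, ∇w)_{L²}`. -/
def H10 {d : ℕ} (Ω : Set (EuclideanSpace ℝ (Fin d))) : Type := H10Sub Ω

instance {d : ℕ} (Ω : Set (EuclideanSpace ℝ (Fin d))) : NormedAddCommGroup (H10 Ω) :=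
  inferInstanceAs (NormedAddCommGroup (H10Sub Ω))

instance {d : ℕ} (Ω : Set (EuclideanSpace ℝ (Fin d))) : InnerProductSpace ℝ (H10 Ω) :=
  inferInstanceAs (InnerProductSpace ℝ (H10Sub Ω))

/-- The inclusion of `H¹₀(Ω)` in `L²(Ω) × L²(Ω; ℝᵈ)`, `w ↦ (w, ∇w)`. -/
def H10.incl {d : ℕ} (Ω : Set (EuclideanSpace ℝ (Fin d))) :
    H10 Ω →L[ℝ] WithLp 2 (L2 Ω × L2Vec Ω) :=
  (H10Sub Ω).subtypeₗᵢ.toContinuousLinearMap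

/-- The `L²(Ω)` function underlying an element of `H¹₀(Ω)`. -/
def H10.val {d : ℕ} {Ω : Set (EuclideanSpace ℝ (Fin d))} (w : H10 Ω) : L2 Ω :=
  (H10.incl Ω w).fst

/-- The weak gradient of an element of `H¹₀(Ω)`. -/
def H10.grad {d : ℕ} {Ω : Set (EuclideanSpace ℝ (Fin d))} (w : H10 Ω) : L2Vec Ω :=
  (H10.incl Ω w).snd

/-- `H⁻¹(Ω)`, the dual of `H¹₀(Ω)`. -/
abbrev Hneg1 {d : ℕ} (Ω : Set (EuclideanSpace ℝ (Fin d))) : Type :=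
  StrongDual ℝ (H10 Ω)

/-- The embedding `L²(Ω) ⊂ H⁻¹(Ω)`, `g ↦ (w ↦ (g, w)_{L²})`. -/
def ofL2 {d : ℕ} {Ω : Set (EuclideanSpace ℝ (Fin d))} (g : L2 Ω) : Hneg1 Ω :=
  (innerSL ℝ g).comp ((WithLp.fstL 2 ℝ (L2 Ω) (L2Vec Ω)).comp (H10.incl Ω))

/-- `w ∈ H¹₀(Ω)` solves `-Δ w = μ w` weakly with homogeneous Dirichlet condition. -/
def IsDirichletEigen {d : ℕ} {Ω : Set (EuclideanSpace ℝ (Fin d))} (μ : ℝ) (w : H10 Ω) : Prop :=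
  ∀ v : H10 Ω, inner ℝ w.grad v.grad = μ * inner ℝ w.val v.val

/-- `(lam j, φ j)` are the eigenvalues and `L²(Ω)`-orthonormal eigenfunctions of the Dirichlet
Laplacian `-Δ`, with none left out: an eigenfunction that is `L²`-orthogonal to all the `φ j`
vanishes. -/
structure IsDirichletEigensystem {d : ℕ} (Ω : Set (EuclideanSpace ℝ (Fin d)))
    (lam : ℕ → ℝ) (φ : ℕ → H10 Ω) : Prop where
  eigen : ∀ j, IsDirichletEigen (lam j) (φ j)
  orthonormal : Orthonormal ℝ (fun j => (φ j).val)
  exhaustive : ∀ (μ : ℝ) (w : H10 Ω), IsDirichletEigen μ w →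
    (∀ j, inner ℝ w.val (φ j).val = 0) → w = 0

/-- The squared norm `‖v‖²_{Ḣˢ(Ω)} = ∑ⱼ λⱼˢ ⟨v, φⱼ⟩²` of `v ∈ H⁻¹(Ω)`; it is `∞` exactly when
`v ∉ Ḣˢ(Ω)`. -/
def dotHSq {d : ℕ} {Ω : Set (EuclideanSpace ℝ (Fin d))} (lam : ℕ → ℝ) (φ : ℕ → H10 Ω)
    (s : ℝ) (v : Hneg1 Ω) : ℝ≥0∞ :=
  ∑' j, ENNReal.ofReal (lam j ^ s * v (φ j) ^ 2)

/-- The norm `‖u‖_{L²(0,t;Ḣˢ(Ω))}`, with value in `[0,∞]`. -/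
def normL2DotH {d : ℕ} {Ω : Set (EuclideanSpace ℝ (Fin d))} (lam : ℕ → ℝ) (φ : ℕ → H10 Ω)
    (s t : ℝ) (u : ℝ → Hneg1 Ω) : ℝ≥0∞ :=
  (∫⁻ τ in Ioo 0 t, dotHSq lam φ s (u τ)) ^ (1 / 2 : ℝ)

/-- `u ∈ L²(0,T;Ḣˢ(Ω))`. -/
def MemL2DotH {d : ℕ} {Ω : Set (EuclideanSpace ℝ (Fin d))} (lam : ℕ → ℝ) (φ : ℕ → H10 Ω)
    (s T : ℝ) (u : ℝ → Hneg1 Ω) : Prop :=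
  AEStronglyMeasurable u (volume.restrict (Ioo 0 T)) ∧ normL2DotH lam φ s T u < ⊤

/-- The multinomial Mittag-Leffler function `E_{(β₁,…,βₙ),β}(z₁,…,zₙ)`. -/
def multiML {n : ℕ} (βs : Fin n → ℝ) (β : ℝ) (z : Fin n → ℝ) : ℝ :=
  ∑' k : ℕ, ∑ l ∈ Finset.piAntidiag (Finset.univ : Finset (Fin n)) k,
    (Nat.multinomial Finset.univ l : ℝ) * (∏ i, z i ^ l i) / Real.Gamma (β + ∑ i, βs i * l i)

/-- The scalar kernel
`t^{α-1} E_{(α,α-α₁,…,α-αₘ),α}(-μ t^α, -b₁ t^{α-α₁}, …, -bₘ t^{α-αₘ})`. -/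
def kernelE {m : ℕ} (α : ℝ) (a b : Fin m → ℝ) (μ t : ℝ) : ℝ :=
  t ^ (α - 1) * multiML (Fin.cons α fun i => α - a i : Fin (m + 1) → ℝ) α
    (Fin.cons (-μ * t ^ α) fun i => -b i * t ^ (α - a i) : Fin (m + 1) → ℝ)

/-- The `j`-th term of the series that defines `Ē(t) χ`. -/
def EbarTerm {d m : ℕ} {Ω : Set (EuclideanSpace ℝ (Fin d))} (lam : ℕ → ℝ) (φ : ℕ → H10 Ω)
    (α : ℝ) (a b : Fin m → ℝ) (t : ℝ) (χ : Hneg1 Ω) (j : ℕ) : Hneg1 Ω :=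
  (kernelE α a b (lam j) t * χ (φ j)) • ofL2 (φ j).val

/-- The operator `Ē(t) χ`, the sum of its series in `H⁻¹(Ω)`. -/
def Ebar {d m : ℕ} {Ω : Set (EuclideanSpace ℝ (Fin d))} (lam : ℕ → ℝ) (φ : ℕ → H10 Ω)
    (α : ℝ) (a b : Fin m → ℝ) (t : ℝ) (χ : Hneg1 Ω) : Hneg1 Ω :=
  ∑' j, EbarTerm lam φ α a b t χ j

/-- The solution representation with zero initial data, `u(t) = ∫₀ᵗ Ē(t-s) f(s) ds`
(a Bochner integral in `H⁻¹(Ω)`). -/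
def solRep {d m : ℕ} {Ω : Set (EuclideanSpace ℝ (Fin d))} (lam : ℕ → ℝ) (φ : ℕ → H10 Ω)
    (α : ℝ) (a b : Fin m → ℝ) (f : ℝ → Hneg1 Ω) (t : ℝ) : Hneg1 Ω :=
  ∫ s in Ioo 0 t, Ebar lam φ α a b (t - s) (f s)

/-- `g` is the (weak) Caputo derivative of order `β ∈ (0,1)` on `(0,T)` of a function `u` with zero
initial data: the fractional integral `Γ(1-β)⁻¹ ∫₀ᵗ (t-τ)^{-β} u(τ) dτ` is absolutely continuous,
vanishes at `0`, and has derivative `g`. If `u` is absolutely continuous with `u(0) = 0`, this `g`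
is `Γ(1-β)⁻¹ ∫₀ᵗ (t-τ)^{-β} u'(τ) dτ`. It determines `g` almost everywhere. -/
def HasCaputoDeriv {X : Type*} [NormedAddCommGroup X] [NormedSpace ℝ X]
    (β T : ℝ) (u g : ℝ → X) : Prop :=
  IntegrableOn u (Ioo 0 T) ∧ IntegrableOn g (Ioo 0 T) ∧
    ∀ᵐ t ∂(volume.restrict (Ioo 0 T)),
      IntegrableOn (fun τ => (t - τ) ^ (-β) • u τ) (Ioo 0 t) ∧
      (Real.Gamma (1 - β))⁻¹ • ∫ τ in Ioo 0 t, (t - τ) ^ (-β) • u τ = ∫ τ in Ioo 0 t, g τ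

/-- `g = P(∂ₜ) u` on `(0,T)`, where `P(∂ₜ) = ∂ₜ^α + ∑ᵢ bᵢ ∂ₜ^{αᵢ}` and every term is the weak Caputo
derivative of a function with zero initial data. -/
def HasMultiTermDeriv {X : Type*} [NormedAddCommGroup X] [NormedSpace ℝ X] {m : ℕ}
    (α : ℝ) (a b : Fin m → ℝ) (T : ℝ) (u g : ℝ → X) : Prop :=
  ∃ (g₀ : ℝ → X) (gs : Fin m → ℝ → X),
    HasCaputoDeriv α T u g₀ ∧ (∀ i, HasCaputoDeriv (a i) T u (gs i)) ∧
    ∀ᵐ t ∂(volume.restrict (Ioo 0 T)), g t = g₀ t + ∑ i, b i • gs i t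

end

end FracDiffusion

open FracDiffusion

/-!
Expanding in eigenfunctions reduces the theorem to the scalar kernels
`K_μ(t) = t^{α-1} E(-μ t^α, -b₁ t^{α-α₁}, …)`, which solve `P(∂ₜ) K_μ + μ K_μ = δ`. A first-zero
argument shows `K_μ > 0`, and then `μ ∫ K_μ ≤ 1`, so Young's inequality bounds `λⱼ K_{λⱼ} * fⱼ` by
`fⱼ` in `L²(0,t)`: this is the estimate for `u`, and the one for `f + Δu` follows. The resolvent
identity `K_0 - K_μ = μ K_0 * K_μ` has two consequences. Firstly `K_μ ≤ K_0`, so the scalar kernel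
`K_0` dominates the Bochner integral that defines `u`. Secondly `u = K_0 * (f + Δu)`, and since
convolution with `K_0` inverts `P(∂ₜ)`, this gives `P(∂ₜ)u = f + Δu`. Finally, Poincaré's inequality
bounds the `λⱼ` away from zero, which puts `Ḣ^q(Ω)` inside `H⁻¹(Ω)` for `q ≥ -1`.
-/

namespace FracDiffusion

noncomputable section

/-! ### Multinomial Mittag-Leffler kernels -/

section Translation

variable (R M : Type*) [CommSemiring R] [AddCommMonoid M]

/-- The representation of the monoid algebra of `M` on functions in which `single y c` acts as
`F ↦ c • F(· + y)`. -/
def translate : AddMonoidAlgebra R M →ₐ[R] Module.End R (M → R) :=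
  AddMonoidAlgebra.lift R (Module.End R (M → R)) M
    { toFun := fun y => LinearMap.funLeft R R fun x => x + y.toAdd
      map_one' := by ext; simp [LinearMap.funLeft_apply]
      map_mul' := fun y z => by
        ext F x
        simp [LinearMap.funLeft_apply, add_assoc] }

variable {R M}

theorem translate_single_apply (y : M) (c : R) (F : M → R) (x : M) :
    translate R M (.single y c) F x = c * F (x + y) := by
  simp [translate, AddMonoidAlgebra.lift_single, LinearMap.funLeft_apply]

theorem translate_pow_apply {ι : Type*} [Fintype ι] [DecidableEq ι] (β : ι → M) (w : ι → R)
    (k : ℕ) (F : M → R) (x : M) :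
    translate R M ((∑ i, .single (β i) (w i)) ^ k) F x =
      ∑ l ∈ Finset.piAntidiag Finset.univ k,
        (Nat.multinomial Finset.univ l : R) * (∏ i, w i ^ l i) * F (x + ∑ i, l i • β i) := by
  simp only [Finset.sum_pow_eq_sum_piAntidiag, AddMonoidAlgebra.single_pow,
    AddMonoidAlgebra.prod_single, ← nsmul_eq_mul, map_sum, map_nsmul, LinearMap.sum_apply,
    Finset.sum_apply, LinearMap.smul_apply, Pi.smul_apply, translate_single_apply, smul_mul_assoc]

end Translation

/-- The kernel `t^{x-1} / Γ(x)` of the fractional integral of order `x`. -/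
def fracKer (x t : ℝ) : ℝ := t ^ (x - 1) / Real.Gamma x

/-- The part of the multinomial series of `mlKer` that is homogeneous of degree `k` in `w`. -/
def mlPartial {ι : Type*} [Fintype ι] (β w : ι → ℝ) : ℕ → ℝ → ℝ → ℝ
  | 0, x, t => fracKer x t
  | k + 1, x, t => ∑ i, w i * mlPartial β w k (x + β i) t

/-- The multinomial Mittag-Leffler kernel
`t^{x-1} E_{(β₁,…,βₙ),x}(w₁ t^{β₁}, …, wₙ t^{βₙ})`, whose Laplace transform is
`z^{-x} / (1 - ∑ᵢ wᵢ z^{-βᵢ})`. -/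
def mlKer {ι : Type*} [Fintype ι] (β w : ι → ℝ) (x t : ℝ) : ℝ :=
  ∑' k, mlPartial β w k x t

section Kernel

variable {ι : Type*} [Fintype ι] {β w : ι → ℝ} {x t : ℝ}

theorem mlPartial_eq_translate_pow (β w : ι → ℝ) (k : ℕ) (x t : ℝ) :
    mlPartial β w k x t =
      translate ℝ ℝ ((∑ i, .single (β i) (w i)) ^ k) (fun y => fracKer y t) x := by
  induction k generalizing x with
  | zero => simp [mlPartial]
  | succ k ih =>
    simp [mlPartial, ih, pow_succ', map_mul, map_sum, translate_single_apply]

theorem rpow_mul_multiML {n : ℕ} (β w : Fin n → ℝ) (x : ℝ) (ht : 0 < t) :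
    t ^ (x - 1) * multiML β x (fun i => w i * t ^ β i) = mlKer β w x t := by
  rw [multiML, mlKer, ← tsum_mul_left]
  refine tsum_congr fun k => ?_
  rw [mlPartial_eq_translate_pow, translate_pow_apply, Finset.mul_sum]
  refine Finset.sum_congr rfl fun l _ => ?_
  have hprod : ∏ i, (w i * t ^ β i) ^ l i = (∏ i, w i ^ l i) * t ^ ∑ i, β i * l i := by
    simp_rw [mul_pow, Finset.prod_mul_distrib, Real.rpow_sum_of_pos ht, Real.rpow_mul ht.le,
      Real.rpow_natCast]
  simp_rw [nsmul_eq_mul, mul_comm (l _ : ℝ)]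
  rw [hprod, fracKer, add_sub_right_comm, Real.rpow_add ht]
  ring

theorem exp_neg_mul_rpow_le_Gamma_of_one_le {A x : ℝ} (hA : 0 < A) (hx : 1 ≤ x) :
    Real.exp (-A) * A ^ (x - 1) ≤ Real.Gamma x := by
  have hx0 : 0 < x := by linarith
  have hconv := Real.GammaIntegral_convergent hx0
  calc Real.exp (-A) * A ^ (x - 1)
      = ∫ y in Ioi A, Real.exp (-y) * A ^ (x - 1) := by
        rw [integral_mul_const, integral_exp_neg_Ioi]
    _ ≤ ∫ y in Ioi A, Real.exp (-y) * y ^ (x - 1) := by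
        have hexp : IntegrableOn (fun y => Real.exp (-y)) (Ioi A) := by
          simpa only [neg_one_mul] using exp_neg_integrableOn_Ioi A one_pos
        exact setIntegral_mono_on (hexp.mul_const _) (hconv.mono_set (Ioi_subset_Ioi hA.le))
          measurableSet_Ioi fun y (hy : A < y) => by gcongr
    _ ≤ ∫ y in Ioi 0, Real.exp (-y) * y ^ (x - 1) := by
        refine setIntegral_mono_set hconv ?_ (Ioi_subset_Ioi hA.le).eventuallyLE
        filter_upwards [self_mem_ae_restrict measurableSet_Ioi] with y (hy : 0 < y)
        positivity
    _ = Real.Gamma x := (Real.Gamma_eq_integral hx0).symm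

theorem exp_neg_mul_rpow_le_Gamma {A x : ℝ} (hA : 1 ≤ A) (hx : 0 < x) :
    Real.exp (-A) * A ^ (x - 1) ≤ Real.Gamma x := by
  have hA0 : 0 < A := by linarith
  rcases le_or_gt 1 x with h | h
  · exact exp_neg_mul_rpow_le_Gamma_of_one_le hA0 h
  · calc Real.exp (-A) * A ^ (x - 1) ≤ Real.exp (-A) * A ^ (x + 1 - 1) := by
          gcongr
          linarith
      _ ≤ Real.Gamma (x + 1) := exp_neg_mul_rpow_le_Gamma_of_one_le hA0 (by linarith)
      _ = x * Real.Gamma x := Real.Gamma_add_one hx.ne'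
      _ ≤ Real.Gamma x := mul_le_of_le_one_left (Real.Gamma_pos_of_pos hx).le h.le

theorem fracKer_nonneg (hx : 0 < x) (ht : 0 ≤ t) : 0 ≤ fracKer x t :=
  div_nonneg (Real.rpow_nonneg ht _) (Real.Gamma_pos_of_pos hx).le

theorem fracKer_one (t : ℝ) : fracKer 1 t = 1 := by simp [fracKer]

theorem fracKer_le {A : ℝ} (hA : 1 ≤ A) (hx : 0 < x) (ht : 0 < t) :
    fracKer x t ≤ Real.exp A * (t / A) ^ (x - 1) := by
  have hA0 : 0 < A := by linarith
  rw [fracKer, div_le_iff₀ (Real.Gamma_pos_of_pos hx), Real.div_rpow ht.le hA0.le]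
  calc t ^ (x - 1)
      = Real.exp A * (t ^ (x - 1) / A ^ (x - 1)) * (Real.exp (-A) * A ^ (x - 1)) := by
        rw [Real.exp_neg]; field_simp
    _ ≤ _ := by gcongr; exact exp_neg_mul_rpow_le_Gamma hA hx

theorem abs_mlPartial_le (hβ : ∀ i, 0 ≤ β i) {A : ℝ} (hA : 1 ≤ A) (hx : 0 < x) (ht : 0 < t)
    (k : ℕ) :
    |mlPartial β w k x t| ≤
      Real.exp A * (t / A) ^ (x - 1) * (∑ i, |w i| * (t / A) ^ β i) ^ k := by
  induction k generalizing x with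
  | zero =>
    rw [pow_zero, mul_one, mlPartial, abs_of_nonneg (fracKer_nonneg hx ht.le)]
    exact fracKer_le hA hx ht
  | succ k ih =>
    have htA : 0 < t / A := by positivity
    rw [mlPartial, pow_succ', Finset.sum_mul, Finset.mul_sum]
    refine (Finset.abs_sum_le_sum_abs _ _).trans (Finset.sum_le_sum fun i _ => ?_)
    rw [abs_mul]
    refine (mul_le_mul_of_nonneg_left (ih (add_pos_of_pos_of_nonneg hx (hβ i)))
      (abs_nonneg _)).trans_eq ?_
    rw [add_sub_right_comm, Real.rpow_add htA]
    ring

theorem exists_sum_abs_mul_div_rpow_le_half (hβ : ∀ i, 0 < β i) (w : ι → ℝ) (T : ℝ) :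
    ∃ A : ℝ, 1 ≤ A ∧ ∀ t ∈ Ioc 0 T, ∑ i, |w i| * (t / A) ^ β i ≤ 1 / 2 := by
  have hlim : Filter.Tendsto (fun A : ℝ => ∑ i, |w i| * (T / A) ^ β i) .atTop (nhds 0) := by
    rw [show (0 : ℝ) = ∑ i, |w i| * 0 ^ β i by simp [Real.zero_rpow (hβ _).ne']]
    exact tendsto_finsetSum _ fun i _ => ((tendsto_const_nhds.div_atTop
      Filter.tendsto_id).rpow_const (Or.inr (hβ i).le)).const_mul _
  obtain ⟨A, hA1, hA⟩ := ((Filter.eventually_ge_atTop (1 : ℝ)).and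
    (hlim.eventually_le_const (show (0 : ℝ) < 1 / 2 by norm_num))).exists
  refine ⟨A, hA1, fun t ht => le_trans (Finset.sum_le_sum fun i _ => ?_) hA⟩
  have htA : 0 ≤ t / A := div_nonneg ht.1.le (by linarith)
  gcongr
  · exact (hβ i).le
  · exact ht.2

theorem exists_abs_mlPartial_le (hβ : ∀ i, 0 < β i) (w : ι → ℝ) (T : ℝ) (hx : 0 < x) :
    ∃ C : ℝ, 0 ≤ C ∧ ∀ k, ∀ t ∈ Ioc 0 T,
      |mlPartial β w k x t| ≤ C * t ^ (x - 1) * (1 / 2) ^ k := by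
  obtain ⟨A, hA1, hA⟩ := exists_sum_abs_mul_div_rpow_le_half hβ w T
  have hA0 : 0 < A := by linarith
  refine ⟨Real.exp A / A ^ (x - 1), by positivity, fun k t ht => ?_⟩
  have ht0 : 0 < t := ht.1
  calc |mlPartial β w k x t|
      ≤ Real.exp A * (t / A) ^ (x - 1) * (∑ i, |w i| * (t / A) ^ β i) ^ k :=
        abs_mlPartial_le (fun i => (hβ i).le) hA1 hx ht0 k
    _ ≤ Real.exp A * (t / A) ^ (x - 1) * (1 / 2) ^ k := by gcongr; exact hA t ht
    _ = _ := by rw [Real.div_rpow ht0.le hA0.le]; ring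

theorem summable_mlPartial (hβ : ∀ i, 0 < β i) (hx : 0 < x) (ht : 0 < t) :
    Summable fun k => mlPartial β w k x t := by
  obtain ⟨C, -, hC⟩ := exists_abs_mlPartial_le hβ w t hx
  exact (summable_geometric_two.mul_left (C * t ^ (x - 1))).of_norm_bounded
    fun k => hC k t ⟨ht, le_rfl⟩

theorem mlKer_eq_add (hβ : ∀ i, 0 < β i) (hx : 0 < x) (ht : 0 < t) :
    mlKer β w x t = fracKer x t + ∑ i, w i * mlKer β w (x + β i) t := by
  rw [mlKer, (summable_mlPartial hβ hx ht).tsum_eq_zero_add]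
  simp only [mlPartial, mlKer]
  rw [Summable.tsum_finsetSum fun i _ =>
    (summable_mlPartial hβ (add_pos hx (hβ i)) ht).mul_left _]
  simp only [tsum_mul_left]

theorem exists_abs_mlKer_le (hβ : ∀ i, 0 < β i) (w : ι → ℝ) (T : ℝ) (hx : 0 < x) :
    ∃ C : ℝ, 0 ≤ C ∧ ∀ t ∈ Ioc 0 T, |mlKer β w x t| ≤ C * t ^ (x - 1) := by
  obtain ⟨C, hC0, hC⟩ := exists_abs_mlPartial_le hβ w T hx
  refine ⟨C * 2, by positivity, fun t ht => ?_⟩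
  have hsum : HasSum (fun k : ℕ => C * t ^ (x - 1) * (1 / 2) ^ k) (C * t ^ (x - 1) * 2) :=
    hasSum_geometric_two.mul_left _
  rw [mul_right_comm]
  exact tsum_of_norm_bounded (f := fun k => mlPartial β w k x t) hsum fun k => hC k t ht

theorem continuousOn_fracKer (x : ℝ) : ContinuousOn (fracKer x) (Ioi 0) :=
  (continuousOn_id.rpow_const fun _ ht => Or.inl (ne_of_gt ht)).div_const _

theorem continuousOn_mlPartial (β w : ι → ℝ) (k : ℕ) (x : ℝ) :
    ContinuousOn (mlPartial β w k x) (Ioi 0) := by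
  induction k generalizing x with
  | zero => exact continuousOn_fracKer x
  | succ k ih => exact continuousOn_finsetSum _ fun i _ => continuousOn_const.mul (ih _)

theorem continuousOn_mlKer (hβ : ∀ i, 0 < β i) (hx : 0 < x) :
    ContinuousOn (mlKer β w x) (Ioi 0) := by
  intro t (ht : 0 < t)
  obtain ⟨C, hC0, hC⟩ := exists_abs_mlPartial_le hβ w (2 * t) hx
  have hpos : ∀ s ∈ Icc (t / 2) (2 * t), 0 < s := fun s hs => (half_pos ht).trans_le hs.1
  have hpow : ContinuousOn (fun s : ℝ => s ^ (x - 1)) (Icc (t / 2) (2 * t)) :=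
    continuousOn_id.rpow_const fun s hs => Or.inl (hpos s hs).ne'
  obtain ⟨B, hB⟩ := isCompact_Icc.exists_bound_of_continuousOn hpow
  have hcont : ContinuousOn (mlKer β w x) (Icc (t / 2) (2 * t)) := by
    refine continuousOn_tsum
      (fun k => (continuousOn_mlPartial β w k x).mono fun s hs => hpos s hs)
      (summable_geometric_two.mul_left (C * B)) fun k s hs => ?_
    refine (hC k s ⟨hpos s hs, hs.2⟩).trans ?_
    gcongr
    exact (le_abs_self _).trans (hB s hs)
  exact (hcont.continuousAt (Icc_mem_nhds (by linarith) (by linarith))).continuousWithinAt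

theorem integrableOn_rpow_sub_one (hx : 0 < x) (T : ℝ) :
    IntegrableOn (fun t : ℝ => t ^ (x - 1)) (Ioo 0 T) := by
  rcases le_or_gt T 0 with hT | hT
  · simp [Ioo_eq_empty hT.not_gt]
  · exact (intervalIntegral.integrableOn_Ioo_rpow_iff hT).2 (by linarith)

theorem integrableOn_fracKer (hx : 0 < x) (T : ℝ) : IntegrableOn (fracKer x) (Ioo 0 T) :=
  (integrableOn_rpow_sub_one hx T).div_const _

theorem integrableOn_mlKer (hβ : ∀ i, 0 < β i) (hx : 0 < x) (T : ℝ) :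
    IntegrableOn (mlKer β w x) (Ioo 0 T) := by
  obtain ⟨C, -, hC⟩ := exists_abs_mlKer_le hβ w T hx
  refine Integrable.mono' ((integrableOn_rpow_sub_one hx T).const_mul C)
    (((continuousOn_mlKer hβ hx).mono Ioo_subset_Ioi_self).aestronglyMeasurable
      measurableSet_Ioo) ?_
  filter_upwards [self_mem_ae_restrict measurableSet_Ioo] with t ht
  exact hC t ⟨ht.1, ht.2.le⟩

end Kernel

/-! ### Causal convolution -/

section Convolution

variable {X : Type*} [NormedAddCommGroup X] [NormedSpace ℝ X]

/-- The one-sided convolution `∫₀ᵗ k(t-s) v(s) ds` of a scalar kernel with a vector-valued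
function. -/
def causalConv (k : ℝ → ℝ) (v : ℝ → X) (t : ℝ) : X := ∫ s in Ioo 0 t, k (t - s) • v s

/-- The integral that defines `causalConv k v t` converges. -/
abbrev CausalConvExistsAt (k : ℝ → ℝ) (v : ℝ → X) (t : ℝ) : Prop :=
  IntegrableOn (fun s => k (t - s) • v s) (Ioo 0 t)

variable {k l : ℝ → ℝ} {v w : ℝ → X} {t T : ℝ}

theorem causalConv_of_nonpos (k : ℝ → ℝ) (v : ℝ → X) (ht : t ≤ 0) : causalConv k v t = 0 := by
  simp [causalConv, Ioo_eq_empty ht.not_gt]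

theorem indicator_smul_sub_eq (k : ℝ → ℝ) (v : ℝ → X) (ht : t ≤ T) :
    (Ioo 0 t).indicator (fun s => k (t - s) • v s) =
      fun s => (Ioo 0 T).indicator k (t - s) • (Ioo 0 T).indicator v s := by
  funext s
  simp only [indicator_apply, mem_Ioo]
  split_ifs <;> grind [zero_smul, smul_zero]

theorem causalConv_eq_convolution (k : ℝ → ℝ) (v : ℝ → X) (ht : t ≤ T) :
    causalConv k v t = convolution ((Ioo 0 T).indicator k) ((Ioo 0 T).indicator v)
      (ContinuousLinearMap.lsmul ℝ ℝ) volume t := by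
  rw [convolution_eq_swap, causalConv, ← integral_indicator measurableSet_Ioo,
    indicator_smul_sub_eq k v ht]
  rfl

theorem causalConvExistsAt_iff (k : ℝ → ℝ) (v : ℝ → X) (ht : t ≤ T) :
    CausalConvExistsAt k v t ↔
      ConvolutionExistsAt ((Ioo 0 T).indicator k) ((Ioo 0 T).indicator v) t
        (ContinuousLinearMap.lsmul ℝ ℝ) volume := by
  rw [convolutionExistsAt_iff_integrable_swap, CausalConvExistsAt,
    ← integrable_indicator_iff measurableSet_Ioo, indicator_smul_sub_eq k v ht]
  rfl

theorem ae_causalConvExistsAt (hk : IntegrableOn k (Ioo 0 T)) (hv : IntegrableOn v (Ioo 0 T)) :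
    ∀ᵐ t ∂volume.restrict (Ioo 0 T), CausalConvExistsAt k v t := by
  rw [← integrable_indicator_iff measurableSet_Ioo] at hk hv
  filter_upwards [self_mem_ae_restrict measurableSet_Ioo,
    ae_restrict_of_ae (hk.ae_convolution_exists (ContinuousLinearMap.lsmul ℝ ℝ) hv)] with t ht h
  exact (causalConvExistsAt_iff k v ht.2.le).2 h

theorem integrableOn_causalConv (hk : IntegrableOn k (Ioo 0 T)) (hv : IntegrableOn v (Ioo 0 T)) :
    IntegrableOn (causalConv k v) (Ioo 0 T) := by
  rw [← integrable_indicator_iff measurableSet_Ioo] at hk hv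
  exact (hk.integrable_convolution (ContinuousLinearMap.lsmul ℝ ℝ) hv).integrableOn.congr_fun
    (fun t ht => (causalConv_eq_convolution k v ht.2.le).symm) measurableSet_Ioo

theorem ae_restrict_comp_sub_left {P : ℝ → Prop} (hP : ∀ᵐ s ∂volume.restrict (Ioo 0 T), P s)
    (ht : t ≤ T) : ∀ᵐ s ∂volume.restrict (Ioo 0 t), P (t - s) := by
  rw [ae_restrict_iff' measurableSet_Ioo] at hP ⊢
  filter_upwards
    [(quasiMeasurePreserving_sub_left_of_right_invariant (volume : Measure ℝ) t).ae hP] with s h hs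
  exact h ⟨by linarith [hs.2], by linarith [hs.1]⟩

theorem causalConv_congr (hkl : k =ᵐ[volume.restrict (Ioo 0 T)] l)
    (hvw : v =ᵐ[volume.restrict (Ioo 0 T)] w) (ht : t ≤ T) :
    causalConv k v t = causalConv l w t := by
  refine integral_congr_ae ?_
  filter_upwards [ae_restrict_comp_sub_left hkl ht,
    ae_restrict_of_ae_restrict_of_subset (Ioo_subset_Ioo_right ht) hvw] with s hks hvs
  rw [hks, hvs]

theorem causalConv_comm (k l : ℝ → ℝ) (t : ℝ) : causalConv k l t = causalConv l k t := by
  rw [causalConv_eq_convolution k l le_rfl, causalConv_eq_convolution l k le_rfl,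
    convolution_eq_swap]
  simp only [convolution, ContinuousLinearMap.lsmul_apply, smul_eq_mul, mul_comm]

theorem indicator_causalConv (k : ℝ → ℝ) (v : ℝ → X) (ht : t < T) :
    (Ioo 0 T).indicator (causalConv k v) t =
      convolution ((Ioo 0 T).indicator k) ((Ioo 0 T).indicator v)
        (ContinuousLinearMap.lsmul ℝ ℝ) volume t := by
  rw [← causalConv_eq_convolution k v ht.le]
  rcases le_or_gt t 0 with ht0 | ht0
  · rw [causalConv_of_nonpos _ _ ht0, indicator_of_notMem fun h => h.1.not_ge ht0]
  · rw [indicator_of_mem (show t ∈ Ioo 0 T from ⟨ht0, ht⟩)]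

theorem ae_causalConv_assoc [CompleteSpace X] (hk : IntegrableOn k (Ioo 0 T))
    (hl : IntegrableOn l (Ioo 0 T)) (hv : IntegrableOn v (Ioo 0 T)) :
    ∀ᵐ t ∂volume.restrict (Ioo 0 T),
      causalConv (causalConv k l) v t = causalConv k (causalConv l v) t := by
  rw [← integrable_indicator_iff measurableSet_Ioo] at hk hl hv
  have hlv := hl.norm.integrable_convolution (ContinuousLinearMap.mul ℝ ℝ) hv.norm
  filter_upwards [self_mem_ae_restrict measurableSet_Ioo, ae_restrict_of_ae
    (hk.norm.ae_convolution_exists (ContinuousLinearMap.mul ℝ ℝ) hlv)] with t ht hex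
  have hassoc := convolution_assoc (ContinuousLinearMap.lsmul ℝ ℝ) (ContinuousLinearMap.lsmul ℝ ℝ)
    (ContinuousLinearMap.lsmul ℝ ℝ) (ContinuousLinearMap.lsmul ℝ ℝ)
    (fun (x y : ℝ) (z : X) => mul_smul x y z) hk.1 hl.1 hv.1 (hk.ae_convolution_exists _ hl)
    (hl.norm.ae_convolution_exists (ContinuousLinearMap.mul ℝ ℝ) hv.norm) hex
  rw [causalConv_eq_convolution _ _ ht.2.le, causalConv_eq_convolution _ _ ht.2.le]
  simp only [convolution_eq_swap (x := t), ContinuousLinearMap.lsmul_apply] at hassoc ⊢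
  convert hassoc using 3 with s s
  · by_cases hs : s ∈ Ioo 0 T
    · rw [indicator_causalConv k l (by linarith [hs.1, ht.2])]
    · simp [indicator_of_notMem hs]
  · by_cases hs : s < T
    · rw [indicator_causalConv l v hs]
    · have hts : t - s ∉ Ioo 0 T := fun h => hs (by linarith [h.1, ht.2])
      simp [indicator_of_notMem hts]

theorem causalConv_const_mul_left (c : ℝ) (k : ℝ → ℝ) (v : ℝ → X) (t : ℝ) :
    causalConv (fun s => c * k s) v t = c • causalConv k v t := by
  simp only [causalConv, mul_smul, integral_smul]

theorem causalConv_smul_right (c : ℝ) (k : ℝ → ℝ) (v : ℝ → X) (t : ℝ) :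
    causalConv k (fun s => c • v s) t = c • causalConv k v t := by
  simp only [causalConv, smul_comm _ c, integral_smul]

theorem causalConv_add_left (hk : CausalConvExistsAt k v t) (hl : CausalConvExistsAt l v t) :
    causalConv (fun s => k s + l s) v t = causalConv k v t + causalConv l v t := by
  simp only [causalConv, add_smul]
  exact integral_add hk hl

theorem causalConv_add_right (hv : CausalConvExistsAt k v t) (hw : CausalConvExistsAt k w t) :
    causalConv k (fun s => v s + w s) t = causalConv k v t + causalConv k w t := by
  simp only [causalConv, smul_add]
  exact integral_add hv hw

theorem causalConv_sub_right (hv : CausalConvExistsAt k v t) (hw : CausalConvExistsAt k w t) :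
    causalConv k (fun s => v s - w s) t = causalConv k v t - causalConv k w t := by
  simp only [causalConv, smul_sub]
  exact integral_sub hv hw

variable {ι : Type*} (I : Finset ι) (c : ι → ℝ)

theorem CausalConvExistsAt.sum_left {k : ι → ℝ → ℝ} (hk : ∀ i ∈ I, CausalConvExistsAt (k i) v t) :
    CausalConvExistsAt (fun s => ∑ i ∈ I, c i * k i s) v t := by
  simp only [CausalConvExistsAt, Finset.sum_smul, mul_smul]
  exact integrable_finsetSum _ fun i hi => (hk i hi).smul (c i)

theorem causalConv_sum_left {k : ι → ℝ → ℝ} (hk : ∀ i ∈ I, CausalConvExistsAt (k i) v t) :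
    causalConv (fun s => ∑ i ∈ I, c i * k i s) v t = ∑ i ∈ I, c i • causalConv (k i) v t := by
  simp only [causalConv, Finset.sum_smul, mul_smul, ← integral_smul]
  exact integral_finsetSum _ fun i hi => (hk i hi).smul (c i)

theorem CausalConvExistsAt.sum_right {v : ι → ℝ → X}
    (hv : ∀ i ∈ I, CausalConvExistsAt k (v i) t) :
    CausalConvExistsAt k (fun s => ∑ i ∈ I, c i • v i s) t := by
  simp only [CausalConvExistsAt, Finset.smul_sum, smul_comm (k _) (c _)]
  exact integrable_finsetSum _ fun i hi => (hv i hi).smul (c i)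

theorem causalConv_sum_right {v : ι → ℝ → X} (hv : ∀ i ∈ I, CausalConvExistsAt k (v i) t) :
    causalConv k (fun s => ∑ i ∈ I, c i • v i s) t = ∑ i ∈ I, c i • causalConv k (v i) t := by
  simp only [causalConv, Finset.smul_sum, smul_comm (k _) (c _), ← integral_smul]
  exact integral_finsetSum _ fun i hi => (hv i hi).smul (c i)

end Convolution

/-! ### The semigroup property -/

section Semigroup

variable {x y t : ℝ}

theorem setIntegral_sub_rpow_mul_rpow (hx : 0 < x) (hy : 0 < y) (ht : 0 < t) :
    ∫ s in Ioo 0 t, (t - s) ^ (y - 1) * s ^ (x - 1) =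
      t ^ (x + y - 1) * (Real.Gamma x * Real.Gamma y / Real.Gamma (x + y)) := by
  have hscaled := Complex.betaIntegral_scaled (x : ℂ) (y : ℂ) ht
  rw [Complex.betaIntegral_eq_Gamma_mul_div _ _ (by simpa) (by simpa),
    intervalIntegral.integral_of_le ht.le, integral_Ioc_eq_integral_Ioo] at hscaled
  have hintegrand : ∀ s ∈ Ioo 0 t,
      (s : ℂ) ^ ((x : ℂ) - 1) * ((t : ℂ) - s) ^ ((y : ℂ) - 1) =
        (((t - s) ^ (y - 1) * s ^ (x - 1) : ℝ) : ℂ) := fun s hs => by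
    have hts : 0 ≤ t - s := by linarith [hs.2]
    push_cast [Complex.ofReal_cpow hs.1.le, Complex.ofReal_cpow hts]
    ring
  rw [setIntegral_congr_fun measurableSet_Ioo hintegrand, integral_complex_ofReal] at hscaled
  apply Complex.ofReal_injective
  push_cast [hscaled, Complex.ofReal_cpow ht.le, ← Complex.Gamma_ofReal]
  rfl

theorem integrableOn_sub_rpow_mul_rpow (hx : 0 < x) (hy : 0 < y) (ht : 0 < t) :
    IntegrableOn (fun s => (t - s) ^ (y - 1) * s ^ (x - 1)) (Ioo 0 t) := by
  refine Integrable.of_integral_ne_zero ?_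
  rw [setIntegral_sub_rpow_mul_rpow hx hy ht]
  positivity

theorem causalConv_fracKer_fracKer (hx : 0 < x) (hy : 0 < y) (ht : 0 < t) :
    causalConv (fracKer y) (fracKer x) t = fracKer (x + y) t := by
  simp only [causalConv, fracKer, smul_eq_mul, div_mul_div_comm]
  rw [integral_div, setIntegral_sub_rpow_mul_rpow hx hy ht]
  field_simp

theorem causalConvExistsAt_fracKer (hx : 0 < x) (hy : 0 < y) (ht : 0 < t) {g : ℝ → ℝ} {C : ℝ}
    (hg : ContinuousOn g (Ioi 0)) (hgC : ∀ s ∈ Ioc 0 t, |g s| ≤ C * s ^ (x - 1)) :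
    CausalConvExistsAt (fracKer y) g t := by
  refine ((integrableOn_sub_rpow_mul_rpow hx hy ht).const_mul (C / Real.Gamma y)).mono'
    (ContinuousOn.aestronglyMeasurable (ContinuousOn.fun_smul ?_ (hg.mono Ioo_subset_Ioi_self))
      measurableSet_Ioo) ?_
  · exact (continuousOn_fracKer y).comp (by fun_prop) fun s hs => sub_pos.2 hs.2
  · filter_upwards [self_mem_ae_restrict measurableSet_Ioo] with s hs
    have hker : 0 ≤ fracKer y (t - s) := fracKer_nonneg hy (sub_pos.2 hs.2).le
    calc ‖fracKer y (t - s) • g s‖ = fracKer y (t - s) * |g s| := by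
          rw [norm_smul, Real.norm_of_nonneg hker, Real.norm_eq_abs]
      _ ≤ fracKer y (t - s) * (C * s ^ (x - 1)) := by gcongr; exact hgC s ⟨hs.1, hs.2.le⟩
      _ = _ := by rw [fracKer]; ring

variable {ι : Type*} [Fintype ι] {β w : ι → ℝ}

theorem causalConvExistsAt_fracKer_mlPartial (hβ : ∀ i, 0 < β i) (hx : 0 < x) (hy : 0 < y)
    (ht : 0 < t) (k : ℕ) : CausalConvExistsAt (fracKer y) (mlPartial β w k x) t := by
  obtain ⟨C, -, hC⟩ := exists_abs_mlPartial_le hβ w t hx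
  refine causalConvExistsAt_fracKer hx hy ht (C := C * (1 / 2) ^ k)
    (continuousOn_mlPartial β w k x) fun s hs => (hC k s hs).trans_eq ?_
  ring

theorem causalConvExistsAt_fracKer_mlKer (hβ : ∀ i, 0 < β i) (hx : 0 < x) (hy : 0 < y)
    (ht : 0 < t) : CausalConvExistsAt (fracKer y) (mlKer β w x) t := by
  obtain ⟨C, -, hC⟩ := exists_abs_mlKer_le hβ w t hx
  exact causalConvExistsAt_fracKer hx hy ht (continuousOn_mlKer hβ hx) hC

theorem causalConv_fracKer_mlPartial (hβ : ∀ i, 0 < β i) (hx : 0 < x) (hy : 0 < y) (ht : 0 < t)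
    (k : ℕ) : causalConv (fracKer y) (mlPartial β w k x) t = mlPartial β w k (x + y) t := by
  induction k generalizing x with
  | zero => exact causalConv_fracKer_fracKer hx hy ht
  | succ k ih =>
    have hxβ : ∀ i, 0 < x + β i := fun i => add_pos hx (hβ i)
    rw [show mlPartial β w (k + 1) x = fun s => ∑ i, w i • mlPartial β w k (x + β i) s from rfl,
      causalConv_sum_right _ w fun i _ => causalConvExistsAt_fracKer_mlPartial hβ (hxβ i) hy ht k]
    simp only [ih (hxβ _), add_right_comm x _ y, mlPartial, smul_eq_mul]

theorem summable_integral_norm_fracKer_smul_mlPartial (hβ : ∀ i, 0 < β i) (hx : 0 < x)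
    (hy : 0 < y) (ht : 0 < t) :
    Summable fun k => ∫ s in Ioo 0 t, ‖fracKer y (t - s) • mlPartial β w k x s‖ := by
  obtain ⟨C, -, hC⟩ := exists_abs_mlPartial_le hβ w t hx
  refine (summable_geometric_two.mul_left
    (∫ s in Ioo 0 t, C / Real.Gamma y * ((t - s) ^ (y - 1) * s ^ (x - 1)))).of_nonneg_of_le
    (fun k => by positivity) fun k => ?_
  rw [← integral_mul_const]
  refine setIntegral_mono_on (causalConvExistsAt_fracKer_mlPartial hβ hx hy ht k).norm
    (((integrableOn_sub_rpow_mul_rpow hx hy ht).const_mul _).mul_const _) measurableSet_Ioo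
    fun s hs => ?_
  have hker : 0 ≤ fracKer y (t - s) := fracKer_nonneg hy (sub_pos.2 hs.2).le
  calc ‖fracKer y (t - s) • mlPartial β w k x s‖ = fracKer y (t - s) * |mlPartial β w k x s| := by
        rw [norm_smul, Real.norm_of_nonneg hker, Real.norm_eq_abs]
    _ ≤ fracKer y (t - s) * (C * s ^ (x - 1) * (1 / 2) ^ k) := by
        gcongr; exact hC k s ⟨hs.1, hs.2.le⟩
    _ = _ := by rw [fracKer]; ring

theorem causalConv_fracKer_mlKer (hβ : ∀ i, 0 < β i) (hx : 0 < x) (hy : 0 < y) (ht : 0 < t) :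
    causalConv (fracKer y) (mlKer β w x) t = mlKer β w (x + y) t := by
  simp only [mlKer, ← causalConv_fracKer_mlPartial hβ hx hy ht, causalConv]
  rw [integral_tsum_of_summable_integral_norm
    (fun k => causalConvExistsAt_fracKer_mlPartial hβ hx hy ht k)
    (summable_integral_norm_fracKer_smul_mlPartial hβ hx hy ht)]
  simp only [smul_eq_mul, tsum_mul_left]

theorem mlKer_eq_fracKer_add_causalConv (hβ : ∀ i, 0 < β i) (hx : 0 < x) (ht : 0 < t) :
    mlKer β w x t = fracKer x t + ∑ i, w i * causalConv (fracKer (β i)) (mlKer β w x) t := by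
  simp only [mlKer_eq_add hβ hx ht, causalConv_fracKer_mlKer hβ hx (hβ _) ht]

end Semigroup

/-! ### Positivity of the kernels -/

section Positivity

theorem rpow_sub_le_div_rpow_mul {s t u p x : ℝ} (hs : 0 ≤ s) (hst : s < t) (htu : t ≤ u)
    (hpx : p ≤ x) (hx : x ≤ 1) :
    (u - s) ^ (p - 1) ≤ (u / t) ^ (x - 1) * (t - s) ^ (p - 1) := by
  have ht : 0 < t := by linarith
  have hts : 0 < t - s := by linarith
  have hus : 0 < u - s := by linarith
  have hratio : u / t ≤ (u - s) / (t - s) := by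
    rw [div_le_div_iff₀ ht hts]; nlinarith
  rw [← div_le_iff₀ (by positivity), ← Real.div_rpow hus.le hts.le]
  calc ((u - s) / (t - s)) ^ (p - 1) ≤ (u / t) ^ (p - 1) :=
        Real.rpow_le_rpow_of_nonpos (div_pos (by linarith) ht) hratio (by linarith)
    _ ≤ (u / t) ^ (x - 1) :=
        Real.rpow_le_rpow_of_exponent_le ((one_le_div ht).2 htu) (by linarith)

theorem fracKer_sub_le_div_rpow_mul {s t u p x : ℝ} (hp : 0 < p) (hs : 0 ≤ s) (hst : s < t)
    (htu : t ≤ u) (hpx : p ≤ x) (hx : x ≤ 1) :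
    fracKer p (u - s) ≤ (u / t) ^ (x - 1) * fracKer p (t - s) := by
  have := Real.Gamma_pos_of_pos hp
  rw [fracKer, fracKer, ← mul_div_assoc]
  gcongr
  exact rpow_sub_le_div_rpow_mul hs hst htu hpx hx

theorem integrableOn_fracKer_sub {p : ℝ} (hp : 0 < p) {t u : ℝ} (htu : t ≤ u) :
    IntegrableOn (fun s => fracKer p (u - s)) (Ico t u) := by
  have hpow := ((intervalIntegral.intervalIntegrable_rpow' (a := 0) (b := u - t)
    (show -1 < p - 1 by linarith)).comp_sub_left u).symm
  rw [sub_sub_cancel, sub_zero, intervalIntegrable_iff_integrableOn_Ico_of_le htu] at hpow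
  exact hpow.div_const _

theorem setIntegral_fracKer_sub {p : ℝ} (hp : 0 < p) {t u : ℝ} (htu : t ≤ u) :
    ∫ s in Ico t u, fracKer p (u - s) = fracKer (p + 1) (u - t) := by
  rw [integral_Ico_eq_integral_Ioo, ← integral_Ioc_eq_integral_Ioo,
    ← intervalIntegral.integral_of_le htu,
    intervalIntegral.integral_comp_sub_left (fun s => fracKer p s) u]
  simp only [fracKer, sub_self, intervalIntegral.integral_div]
  rw [integral_rpow (Or.inl (by linarith)), Real.Gamma_add_one hp.ne']
  simp [Real.zero_rpow hp.ne', div_div]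

theorem exists_first_nonpos {g : ℝ → ℝ} (hg : ContinuousOn g (Ioi 0))
    (hg0 : ∀ᶠ s in nhdsWithin 0 (Ioi 0), 0 < g s) {t : ℝ} (ht : 0 < t) (hgt : g t ≤ 0) :
    ∃ u, 0 < u ∧ g u ≤ 0 ∧ ∀ s ∈ Ioo 0 u, 0 < g s := by
  obtain ⟨δ, hδ : 0 < δ, hδpos⟩ := mem_nhdsGT_iff_exists_Ioo_subset.1 hg0
  have hδt : δ ≤ t := not_lt.1 fun h => hgt.not_gt (hδpos ⟨ht, h⟩)
  have hclosed : IsClosed (Icc δ t ∩ g ⁻¹' Iic 0) :=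
    (hg.mono fun s hs => hδ.trans_le hs.1).preimage_isClosed_of_isClosed isClosed_Icc isClosed_Iic
  obtain ⟨u, ⟨hu, hgu⟩, hleast⟩ := (isCompact_Icc.of_isClosed_subset hclosed
    inter_subset_left).exists_isLeast ⟨t, ⟨hδt, le_rfl⟩, hgt⟩
  refine ⟨u, hδ.trans_le hu.1, hgu, fun s hs => ?_⟩
  by_contra! hgs
  rcases lt_or_ge s δ with h | h
  · exact hgs.not_gt (hδpos ⟨hs.1, h⟩)
  · exact hs.2.not_ge (hleast ⟨⟨h, hs.2.le.trans hu.2⟩, hgs⟩)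

variable {ι : Type*} [Fintype ι] {β w : ι → ℝ} {x : ℝ}

theorem tendsto_rpow_mul_mlKer_zero (hβ : ∀ i, 0 < β i) (hx : 0 < x) {y : ℝ} (hxy : x < y) :
    Filter.Tendsto (fun t => t ^ (1 - x) * mlKer β w y t) (nhdsWithin 0 (Ioi 0)) (nhds 0) := by
  obtain ⟨C, -, hC⟩ := exists_abs_mlKer_le hβ w 1 (hx.trans hxy)
  have hlim : Filter.Tendsto (fun t : ℝ => C * t ^ (y - x)) (nhdsWithin 0 (Ioi 0)) (nhds 0) := by
    have hcont := (Real.continuousAt_rpow_const 0 (y - x) (Or.inr (sub_pos.2 hxy).le)).tendsto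
    rw [Real.zero_rpow (sub_pos.2 hxy).ne'] at hcont
    simpa using (hcont.mono_left nhdsWithin_le_nhds).const_mul C
  refine squeeze_zero_norm' ?_ hlim
  filter_upwards [Ioc_mem_nhdsGT one_pos] with t ht
  have ht0 : 0 < t := ht.1
  calc ‖t ^ (1 - x) * mlKer β w y t‖ = t ^ (1 - x) * |mlKer β w y t| := by
        rw [norm_mul, Real.norm_of_nonneg (by positivity), Real.norm_eq_abs]
    _ ≤ t ^ (1 - x) * (C * t ^ (y - 1)) := by gcongr; exact hC t ht
    _ = C * t ^ (y - x) := by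
        rw [mul_left_comm, ← Real.rpow_add ht0, show 1 - x + (y - 1) = y - x by ring]

theorem tendsto_rpow_mul_mlKer (hβ : ∀ i, 0 < β i) (hx : 0 < x) :
    Filter.Tendsto (fun t => t ^ (1 - x) * mlKer β w x t) (nhdsWithin 0 (Ioi 0))
      (nhds (Real.Gamma x)⁻¹) := by
  have hrest : Filter.Tendsto (fun t => ∑ i, w i * (t ^ (1 - x) * mlKer β w (x + β i) t))
      (nhdsWithin 0 (Ioi 0)) (nhds 0) := by
    simpa using tendsto_finsetSum Finset.univ fun i _ => (tendsto_rpow_mul_mlKer_zero (w := w)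
      hβ hx (lt_add_of_pos_right x (hβ i))).const_mul (w i)
  refine ((tendsto_const_nhds (x := (Real.Gamma x)⁻¹)).add hrest).congr' ?_ |>.trans (by simp)
  filter_upwards [self_mem_nhdsWithin] with t (ht : 0 < t)
  rw [mlKer_eq_add hβ hx ht, mul_add, Finset.mul_sum, fracKer, mul_div_assoc',
    ← Real.rpow_add ht, sub_add_sub_cancel, sub_self, Real.rpow_zero, one_div]
  simp only [mul_left_comm]

theorem eventually_mlKer_pos (hβ : ∀ i, 0 < β i) (hx : 0 < x) :
    ∀ᶠ t in nhdsWithin 0 (Ioi 0), 0 < mlKer β w x t := by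
  filter_upwards [(tendsto_rpow_mul_mlKer (w := w) hβ hx).eventually_const_lt
    (inv_pos.2 (Real.Gamma_pos_of_pos hx)), self_mem_nhdsWithin] with t h (ht : 0 < t)
  exact pos_of_mul_pos_right h (by positivity)

theorem causalConv_fracKer_le_of_nonneg (hβ : ∀ i, 0 < β i) (hx : 0 < x) (hx1 : x ≤ 1) {p : ℝ}
    (hp : 0 < p) (hpx : p ≤ x) {t u : ℝ} (ht : 0 < t) (htu : t < u)
    (hpos : ∀ s ∈ Ioo 0 u, 0 ≤ mlKer β w x s) :
    causalConv (fracKer p) (mlKer β w x) u ≤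
      (u / t) ^ (x - 1) * causalConv (fracKer p) (mlKer β w x) t +
        ∫ s in Ico t u, fracKer p (u - s) • mlKer β w x s := by
  have hu := causalConvExistsAt_fracKer_mlKer (w := w) hβ hx hp (ht.trans htu)
  have hsplit : Ioo 0 u = Ioo 0 t ∪ Ico t u := (Ioo_union_Ico_eq_Ioo ht htu.le).symm
  have hut := hu.mono_set (Ioo_subset_Ioo_right htu.le)
  have hdisj : Disjoint (Ioo 0 t) (Ico t u) :=
    Set.disjoint_left.2 fun s hs hs' => hs.2.not_ge hs'.1
  rw [causalConv, hsplit, setIntegral_union hdisj measurableSet_Ico hut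
    (hu.mono_set (hsplit ▸ subset_union_right)), causalConv, ← integral_const_mul]
  refine add_le_add (setIntegral_mono_on hut
    ((causalConvExistsAt_fracKer_mlKer hβ hx hp ht).const_mul _) measurableSet_Ioo fun s hs => ?_)
    le_rfl
  rw [smul_eq_mul, smul_eq_mul, ← mul_assoc]
  exact mul_le_mul_of_nonneg_right (fracKer_sub_le_div_rpow_mul hp hs.1.le hs.2 htu.le hpx hx1)
    (hpos s ⟨hs.1, hs.2.trans htu⟩)

theorem mlKer_ge_of_nonneg (hβ : ∀ i, 0 < β i) (hw : ∀ i, w i ≤ 0) (hx : 0 < x)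
    (hx1 : x ≤ 1) (hβx : ∀ i, β i ≤ x) {t u : ℝ} (ht : 0 < t) (htu : t < u)
    (hpos : ∀ s ∈ Ioo 0 u, 0 ≤ mlKer β w x s) :
    (u / t) ^ (x - 1) * mlKer β w x t +
      ∑ i, w i * ∫ s in Ico t u, fracKer (β i) (u - s) • mlKer β w x s ≤ mlKer β w x u := by
  have hu : 0 < u := ht.trans htu
  have hleading : (u / t) ^ (x - 1) * fracKer x t = fracKer x u := by
    rw [fracKer, fracKer, Real.div_rpow hu.le ht.le]
    field_simp
  rw [mlKer_eq_fracKer_add_causalConv hβ hx ht, mlKer_eq_fracKer_add_causalConv hβ hx hu, mul_add,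
    Finset.mul_sum, add_assoc, ← Finset.sum_add_distrib, hleading]
  gcongr with i
  refine le_trans (le_of_eq (by ring)) (mul_le_mul_of_nonpos_left
    (causalConv_fracKer_le_of_nonneg hβ hx hx1 (hβ i) (hβx i) ht htu hpos) (hw i))

theorem setIntegral_fracKer_smul_mlKer_le (hβ : ∀ i, 0 < β i) (hx : 0 < x) {p : ℝ} (hp : 0 < p)
    {v u M : ℝ} (hv : 0 < v) (hvu : v ≤ u) (hM : ∀ s ∈ Ico v u, mlKer β w x s ≤ M) :
    ∫ s in Ico v u, fracKer p (u - s) • mlKer β w x s ≤ M * fracKer (p + 1) (u - v) := by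
  rw [← setIntegral_fracKer_sub hp hvu, ← integral_const_mul]
  refine setIntegral_mono_on
    ((causalConvExistsAt_fracKer_mlKer hβ hx hp (hv.trans_le hvu)).mono_set
      fun s hs => ⟨hv.trans_le hs.1, hs.2⟩)
    ((integrableOn_fracKer_sub hp hvu).const_mul _) measurableSet_Ico fun s hs => ?_
  rw [smul_eq_mul, mul_comm]
  exact mul_le_mul_of_nonneg_right (hM s hs) (fracKer_nonneg hp (sub_pos.2 hs.2).le)

theorem tendsto_fracKer_sub_nhdsLT {p : ℝ} (hp : 0 < p) (u : ℝ) :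
    Filter.Tendsto (fun r => fracKer (p + 1) (u - r)) (nhdsWithin u (Iio u)) (nhds 0) := by
  have hcont : ContinuousAt (fun r => fracKer (p + 1) (u - r)) u :=
    (ContinuousAt.rpow_const (by fun_prop) (Or.inr (by linarith))).div_const _
  have hlim := hcont.tendsto.mono_left (nhdsWithin_le_nhds (s := Iio u))
  simpa [fracKer, Real.zero_rpow hp.ne'] using hlim

theorem fracKer_add_one_le_of_le {p s t : ℝ} (hp : 0 ≤ p) (hs : 0 ≤ s) (hst : s ≤ t) :
    fracKer (p + 1) s ≤ fracKer (p + 1) t := by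
  have := Real.Gamma_pos_of_pos (add_pos_of_nonneg_of_pos hp one_pos)
  rw [fracKer, fracKer, add_sub_cancel_right]
  gcongr

theorem half_le_div_rpow {u v : ℝ} (hv : 0 < v) (hvu : v ≤ u) (huv : u ≤ 2 * v) (hx : 0 ≤ x) :
    1 / 2 ≤ (u / v) ^ (x - 1) := by
  have hu : 0 < u := hv.trans_le hvu
  calc (1 / 2 : ℝ) ≤ (u / v)⁻¹ := by
        rw [inv_div, div_le_div_iff₀ two_pos hu]; linarith
    _ = (u / v) ^ (-1 : ℝ) := (Real.rpow_neg_one _).symm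
    _ ≤ _ := Real.rpow_le_rpow_of_exponent_le ((one_le_div hv).2 hvu) (by linarith)

/-- At a first zero `u`, the memory of the positive past, transported from a nearby maximum point
`v`, outweighs the negative contributions of `(v, u)`. -/
theorem mlKer_pos_of_pos_before (hβ : ∀ i, 0 < β i) (hw : ∀ i, w i ≤ 0) (hx : 0 < x)
    (hx1 : x ≤ 1) (hβx : ∀ i, β i ≤ x) {u : ℝ} (hu : 0 < u)
    (hpos : ∀ s ∈ Ioo 0 u, 0 < mlKer β w x s) : 0 < mlKer β w x u := by
  by_contra! hKu
  have hsmall : Filter.Tendsto (fun r => ∑ i, w i * fracKer (β i + 1) (u - r))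
      (nhdsWithin u (Iio u)) (nhds 0) := by
    simpa using tendsto_finsetSum Finset.univ
      fun i _ => (tendsto_fracKer_sub_nhdsLT (hβ i) u).const_mul (w i)
  obtain ⟨r, hr, hur, hru⟩ :=
    ((hsmall.eventually_const_lt (show -(1 / 2 : ℝ) < 0 by norm_num)).and
      (Ioo_mem_nhdsLT (show u / 2 < u by linarith))).exists
  have hr0 : 0 < r := by linarith
  obtain ⟨v, ⟨hrv, hvu⟩, hvmax⟩ := isCompact_Icc.exists_isMaxOn ⟨r, le_rfl, hru.le⟩
    ((continuousOn_mlKer (w := w) hβ hx).mono fun s (hs : s ∈ Icc r u) => hr0.trans_le hs.1)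
  have hKv : 0 < mlKer β w x v := (hpos r ⟨hr0, hru⟩).trans_le (hvmax ⟨le_rfl, hru.le⟩)
  have hv0 : 0 < v := by linarith
  replace hvu : v < u := hvu.lt_of_ne (by rintro rfl; linarith)
  have hrecent : ∀ i, w i * fracKer (β i + 1) (u - r) * mlKer β w x v ≤
      w i * ∫ s in Ico v u, fracKer (β i) (u - s) • mlKer β w x s := fun i => by
    rw [mul_assoc]
    refine mul_le_mul_of_nonpos_left ?_ (hw i)
    calc ∫ s in Ico v u, fracKer (β i) (u - s) • mlKer β w x s
        ≤ mlKer β w x v * fracKer (β i + 1) (u - v) :=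
          setIntegral_fracKer_smul_mlKer_le hβ hx (hβ i) hv0 hvu.le
            fun s hs => hvmax ⟨hrv.trans hs.1, hs.2.le⟩
      _ ≤ fracKer (β i + 1) (u - r) * mlKer β w x v := by
          rw [mul_comm]
          gcongr
          exact fracKer_add_one_le_of_le (hβ i).le (by linarith) (by linarith)
  have hge := mlKer_ge_of_nonneg hβ hw hx hx1 hβx hv0 hvu fun s hs => (hpos s hs).le
  have hratio := half_le_div_rpow hv0 hvu.le (by linarith) hx.le
  have hsum := Finset.sum_le_sum fun i (_ : i ∈ Finset.univ) => hrecent i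
  rw [← Finset.sum_mul] at hsum
  nlinarith

theorem mlKer_pos (hβ : ∀ i, 0 < β i) (hw : ∀ i, w i ≤ 0) (hx : 0 < x) (hx1 : x ≤ 1)
    (hβx : ∀ i, β i ≤ x) {t : ℝ} (ht : 0 < t) : 0 < mlKer β w x t := by
  by_contra! hKt
  obtain ⟨u, hu, hKu, hpos⟩ :=
    exists_first_nonpos (continuousOn_mlKer hβ hx) (eventually_mlKer_pos hβ hx) ht hKt
  exact hKu.not_gt (mlKer_pos_of_pos_before hβ hw hx hx1 hβx hu hpos)

end Positivity

/-! ### The resolvent identity -/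

section Resolvent

variable {X : Type*} [NormedAddCommGroup X] [NormedSpace ℝ X]
  {ι : Type*} [Fintype ι] {β w : ι → ℝ} {x y γ T : ℝ} {v : ℝ → X}

theorem ae_causalConv_mlKer_expand (hβ : ∀ i, 0 < β i) (hx : 0 < x)
    (hv : IntegrableOn v (Ioo 0 T)) :
    ∀ᵐ t ∂volume.restrict (Ioo 0 T), causalConv (mlKer β w x) v t =
      causalConv (fracKer x) v t + ∑ i, w i • causalConv (mlKer β w (x + β i)) v t := by
  have hexpand : mlKer β w x =ᵐ[volume.restrict (Ioo 0 T)]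
      fun t => fracKer x t + ∑ i, w i * mlKer β w (x + β i) t := by
    filter_upwards [self_mem_ae_restrict measurableSet_Ioo] with t ht
    exact mlKer_eq_add hβ hx ht.1
  filter_upwards [self_mem_ae_restrict measurableSet_Ioo,
    ae_causalConvExistsAt (integrableOn_fracKer hx T) hv,
    ae_all_iff.2 fun i => ae_causalConvExistsAt
      (integrableOn_mlKer (w := w) hβ (add_pos hx (hβ i)) T) hv] with t ht hfrac hml
  rw [causalConv_congr hexpand .rfl ht.2.le,
    causalConv_add_left hfrac (.sum_left _ w fun i _ => hml i),
    causalConv_sum_left _ w fun i _ => hml i]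

theorem ae_causalConv_mlKer_add [CompleteSpace X] (hβ : ∀ i, 0 < β i) (hx : 0 < x) (hγ : 0 < γ)
    (hv : IntegrableOn v (Ioo 0 T)) :
    ∀ᵐ t ∂volume.restrict (Ioo 0 T), causalConv (mlKer β w (x + γ)) v t =
      causalConv (fracKer γ) (causalConv (mlKer β w x) v) t := by
  have hsemigroup : mlKer β w (x + γ) =ᵐ[volume.restrict (Ioo 0 T)]
      causalConv (fracKer γ) (mlKer β w x) := by
    filter_upwards [self_mem_ae_restrict measurableSet_Ioo] with t ht
    rw [causalConv_fracKer_mlKer hβ hx hγ ht.1]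
  filter_upwards [self_mem_ae_restrict measurableSet_Ioo, ae_causalConv_assoc
    (integrableOn_fracKer hγ T) (integrableOn_mlKer (w := w) hβ hx T) hv] with t ht hassoc
  rw [causalConv_congr hsemigroup .rfl ht.2.le, hassoc]

variable {w' : ι → ℝ}

theorem ae_causalConv_mlKer_mlKer_shift (hβ : ∀ i, 0 < β i) (hx : 0 < x) (hy : 0 < y)
    (hγ : 0 < γ) (T : ℝ) :
    ∀ᵐ t ∂volume.restrict (Ioo 0 T), causalConv (mlKer β w (x + γ)) (mlKer β w' y) t =
      causalConv (mlKer β w x) (mlKer β w' (y + γ)) t := by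
  filter_upwards [ae_causalConv_mlKer_add (w := w) hβ hx hγ (integrableOn_mlKer hβ hy T),
    ae_causalConv_mlKer_add (w := w') hβ hy hγ (integrableOn_mlKer hβ hx T)] with t hw hw'
  rw [hw, causalConv_comm (mlKer β w x), hw', funext (causalConv_comm (mlKer β w x) _)]

/-- Expand either factor of `mlKer β w (x / 2) * mlKer β w' (x / 2)` and compare. -/
theorem ae_mlKer_sub_mlKer (hβ : ∀ i, 0 < β i) (hx : 0 < x) (T : ℝ) :
    ∀ᵐ t ∂volume.restrict (Ioo 0 T), mlKer β w x t - mlKer β w' x t =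
      ∑ i, (w i - w' i) * causalConv (mlKer β w (x / 2)) (mlKer β w' (x / 2 + β i)) t := by
  have hx2 : 0 < x / 2 := half_pos hx
  have hint (w : ι → ℝ) := integrableOn_mlKer (w := w) hβ hx2 T
  filter_upwards [self_mem_ae_restrict measurableSet_Ioo,
    ae_causalConv_mlKer_expand (w := w) hβ hx2 (hint w'),
    ae_causalConv_mlKer_expand (w := w') hβ hx2 (hint w),
    ae_all_iff.2 fun i =>
      ae_causalConv_mlKer_mlKer_shift (w := w) (w' := w') hβ hx2 hx2 (hβ i) T]
    with t ht hleft hright hshift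
  rw [causalConv_comm, hright, causalConv_fracKer_mlKer hβ hx2 hx2 ht.1,
    causalConv_fracKer_mlKer hβ hx2 hx2 ht.1, add_halves] at hleft
  simp only [hshift, causalConv_comm (mlKer β w' _) (mlKer β w _), smul_eq_mul] at hleft
  simp only [sub_mul, Finset.sum_sub_distrib]
  linarith

end Resolvent

/-! ### The multi-term kernel -/

section MultiTerm

variable {m : ℕ} {α : ℝ} {a b : Fin m → ℝ} {μ x t : ℝ}

/-- The exponents `α, α - α₁, …, α - αₘ` of the multi-term kernel. -/
def multiExp (α : ℝ) (a : Fin m → ℝ) : Fin (m + 1) → ℝ :=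
  Fin.cons α fun i => α - a i

/-- The coefficients `-μ, -b₁, …, -bₘ` of the multi-term kernel. -/
def multiCoef (b : Fin m → ℝ) (μ : ℝ) : Fin (m + 1) → ℝ :=
  Fin.cons (-μ) fun i => -b i

/-- The kernel `t^{x-1} E_{(α,α-α₁,…,α-αₘ),x}(-μ t^α, -b₁ t^{α-α₁}, …, -bₘ t^{α-αₘ})`; it is
`kernelE` for `x = α`, and convolution with `fracKer y` raises `x` by `y`. -/
def multiKer (α : ℝ) (a b : Fin m → ℝ) (μ x : ℝ) : ℝ → ℝ :=
  mlKer (multiExp α a) (multiCoef b μ) x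

theorem kernelE_eq_multiKer (α : ℝ) (a b : Fin m → ℝ) (μ : ℝ) (ht : 0 < t) :
    kernelE α a b μ t = multiKer α a b μ α t := by
  rw [multiKer, ← rpow_mul_multiML _ _ _ ht, kernelE]
  congr 2
  funext i
  refine Fin.cases ?_ (fun i => ?_) i <;> simp [multiExp, multiCoef]

theorem multiExp_pos (hα0 : 0 < α) (ha : ∀ i, a i < α) : ∀ i, 0 < multiExp α a i :=
  Fin.cases (by simpa [multiExp]) fun i => by simpa [multiExp] using ha i

theorem multiExp_le (ha0 : ∀ i, 0 ≤ a i) : ∀ i, multiExp α a i ≤ α :=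
  Fin.cases (by simp [multiExp]) fun i => by simpa [multiExp] using ha0 i

theorem multiCoef_nonpos (hb : ∀ i, 0 ≤ b i) (hμ : 0 ≤ μ) : ∀ i, multiCoef b μ i ≤ 0 :=
  Fin.cases (by simpa [multiCoef]) fun i => by simpa [multiCoef] using hb i

theorem multiKer_eq (hα0 : 0 < α) (ha : ∀ i, a i < α) (hx : 0 < x) (ht : 0 < t) :
    multiKer α a b μ x t = fracKer x t - μ * multiKer α a b μ (x + α) t -
      ∑ i, b i * multiKer α a b μ (x + (α - a i)) t := by
  rw [multiKer, mlKer_eq_add (multiExp_pos hα0 ha) hx ht, Fin.sum_univ_succ]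
  simp only [multiCoef, multiExp, Fin.cons_zero, Fin.cons_succ, neg_mul, Finset.sum_neg_distrib]
  simp only [multiKer, multiExp, multiCoef]
  ring

theorem continuousOn_multiKer (hα0 : 0 < α) (ha : ∀ i, a i < α) (hx : 0 < x) :
    ContinuousOn (multiKer α a b μ x) (Ioi 0) :=
  continuousOn_mlKer (multiExp_pos hα0 ha) hx

theorem integrableOn_multiKer (hα0 : 0 < α) (ha : ∀ i, a i < α) (hx : 0 < x) (T : ℝ) :
    IntegrableOn (multiKer α a b μ x) (Ioo 0 T) :=
  integrableOn_mlKer (multiExp_pos hα0 ha) hx T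

theorem multiKer_pos (hα0 : 0 < α) (hα1 : α ≤ 1) (ha0 : ∀ i, 0 ≤ a i) (ha : ∀ i, a i < α)
    (hb : ∀ i, 0 ≤ b i) (hμ : 0 ≤ μ) (ht : 0 < t) : 0 < multiKer α a b μ α t :=
  mlKer_pos (multiExp_pos hα0 ha) (multiCoef_nonpos hb hμ) hα0 hα1 (multiExp_le ha0) ht

theorem multiKer_nonneg (hα0 : 0 < α) (hα1 : α ≤ 1) (ha0 : ∀ i, 0 ≤ a i) (ha : ∀ i, a i < α)
    (hb : ∀ i, 0 ≤ b i) (hμ : 0 ≤ μ) (hx : α ≤ x) (ht : 0 < t) : 0 ≤ multiKer α a b μ x t := by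
  rcases hx.eq_or_lt with rfl | hx
  · exact (multiKer_pos hα0 hα1 ha0 ha hb hμ ht).le
  · rw [← add_sub_cancel α x, multiKer,
      ← causalConv_fracKer_mlKer (multiExp_pos hα0 ha) hα0 (sub_pos.2 hx) ht]
    exact setIntegral_nonneg measurableSet_Ioo fun s hs => mul_nonneg
      (fracKer_nonneg (sub_pos.2 hx) (sub_pos.2 hs.2).le)
      (multiKer_pos hα0 hα1 ha0 ha hb hμ hs.1).le

theorem mul_setIntegral_multiKer_le_one (hα0 : 0 < α) (hα1 : α ≤ 1) (ha0 : ∀ i, 0 ≤ a i)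
    (ha : ∀ i, a i < α) (hb : ∀ i, 0 ≤ b i) (hμ : 0 ≤ μ) (t : ℝ) :
    μ * ∫ s in Ioo 0 t, multiKer α a b μ α s ≤ 1 := by
  rcases le_or_gt t 0 with ht | ht
  · simp [Ioo_eq_empty ht.not_gt]
  have hnonneg {x : ℝ} (hx : α ≤ x) : 0 ≤ multiKer α a b μ x t :=
    multiKer_nonneg hα0 hα1 ha0 ha hb hμ hx ht
  have hint : ∫ s in Ioo 0 t, multiKer α a b μ α s = multiKer α a b μ (1 + α) t := by
    rw [add_comm, multiKer, multiKer,
      ← causalConv_fracKer_mlKer (multiExp_pos hα0 ha) hα0 one_pos ht]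
    simp only [causalConv, fracKer_one, one_smul]
  have hexpand := multiKer_eq (b := b) (μ := μ) hα0 ha one_pos ht
  have hlower : 0 ≤ ∑ i, b i * multiKer α a b μ (1 + (α - a i)) t :=
    Finset.sum_nonneg fun i _ => mul_nonneg (hb i) (hnonneg (by linarith [ha i]))
  rw [fracKer_one] at hexpand
  rw [hint]
  linarith [hnonneg hα1]

theorem ae_multiKer_sub_multiKer (hα0 : 0 < α) (ha : ∀ i, a i < α) (μ T : ℝ) :
    ∀ᵐ t ∂volume.restrict (Ioo 0 T), multiKer α a b 0 α t - multiKer α a b μ α t =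
      μ * causalConv (multiKer α a b 0 α) (multiKer α a b μ α) t := by
  have hβ := multiExp_pos hα0 ha
  have hα2 : 0 < α / 2 := half_pos hα0
  filter_upwards [ae_mlKer_sub_mlKer (w := multiCoef b 0) (w' := multiCoef b μ) hβ hα0 T,
    ae_causalConv_mlKer_mlKer_shift (w := multiCoef b 0) (w' := multiCoef b μ) hβ hα2 hα0 hα2 T]
    with t hsub hshift
  rw [add_halves, add_comm α] at hshift
  rw [multiKer, multiKer, hsub, hshift, Fin.sum_univ_succ]
  simp [multiCoef, multiExp]

theorem ae_multiKer_le_multiKer_zero (hα0 : 0 < α) (hα1 : α ≤ 1) (ha0 : ∀ i, 0 ≤ a i)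
    (ha : ∀ i, a i < α) (hb : ∀ i, 0 ≤ b i) (hμ : 0 ≤ μ) (T : ℝ) :
    ∀ᵐ t ∂volume.restrict (Ioo 0 T), multiKer α a b μ α t ≤ multiKer α a b 0 α t := by
  filter_upwards [ae_multiKer_sub_multiKer (b := b) hα0 ha μ T] with t hsub
  have hconv : 0 ≤ causalConv (multiKer α a b 0 α) (multiKer α a b μ α) t :=
    setIntegral_nonneg measurableSet_Ioo fun s hs => mul_nonneg
      (multiKer_pos hα0 hα1 ha0 ha hb le_rfl (sub_pos.2 hs.2)).le
      (multiKer_pos hα0 hα1 ha0 ha hb hμ hs.1).le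
  linarith [mul_nonneg hμ hconv]

end MultiTerm

/-! ### The Poincaré inequality -/

section Poincare

variable {d : ℕ} {Ω : Set (EuclideanSpace ℝ (Fin d))} {ψ : EuclideanSpace ℝ (Fin d) → ℝ} {R : ℝ}

theorem norm_gradient {E : Type*} [NormedAddCommGroup E] [InnerProductSpace ℝ E] [CompleteSpace E]
    (ψ : E → ℝ) (x : E) : ‖gradient ψ x‖ = ‖fderiv ℝ ψ x‖ := by
  rw [gradient, LinearIsometryEquiv.norm_map]

theorem support_gradient_subset {E : Type*} [NormedAddCommGroup E] [InnerProductSpace ℝ E]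
    [CompleteSpace E] (ψ : E → ℝ) : Function.support (gradient ψ) ⊆ tsupport ψ := fun _ hx =>
  support_fderiv_subset ℝ fun h => hx (by simp [gradient, h])

theorem integrable_sq_of_hasCompactSupport (hψ : Continuous ψ) (hc : HasCompactSupport ψ) :
    Integrable fun x => ψ x ^ 2 := by
  refine Continuous.integrable_of_hasCompactSupport (by fun_prop) ?_
  exact hc.comp_left (g := fun y : ℝ => y ^ 2) (by simp)

theorem integrable_norm_gradient_sq (hψ : ContDiff ℝ 1 ψ) (hc : HasCompactSupport ψ) :
    Integrable fun x => ‖gradient ψ x‖ ^ 2 := by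
  simp only [norm_gradient]
  have := hψ.continuous_fderiv one_ne_zero
  refine Continuous.integrable_of_hasCompactSupport (by fun_prop) ?_
  exact (hc.fderiv (𝕜 := ℝ)).comp_left (g := fun L => ‖L‖ ^ 2) (by simp)

theorem integrable_coord_mul_fderiv_sq (i : Fin d) (hψ : ContDiff ℝ 1 ψ)
    (hc : HasCompactSupport ψ) (v : EuclideanSpace ℝ (Fin d)) :
    Integrable fun x => x i * (2 * ψ x * fderiv ℝ ψ x v) := by
  have := hψ.continuous
  have := hψ.continuous_fderiv one_ne_zero
  refine Continuous.integrable_of_hasCompactSupport (by fun_prop) ?_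
  exact HasCompactSupport.mul_left ((hc.mul_left (f := fun _ => (2 : ℝ))).mul_right)

/-- Integration by parts against the coordinate `x i`, whose derivative in direction `i` is `1`. -/
theorem integral_sq_eq_neg_integral_coord_mul (i : Fin d) (hψ : ContDiff ℝ 1 ψ)
    (hc : HasCompactSupport ψ) :
    ∫ x, ψ x ^ 2 =
      -∫ x, x i * (2 * ψ x * fderiv ℝ ψ x (EuclideanSpace.single i 1)) := by
  have hdiff : Differentiable ℝ ψ := hψ.differentiable one_ne_zero
  let coord : EuclideanSpace ℝ (Fin d) →L[ℝ] ℝ := EuclideanSpace.proj i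
  have hcoord (x) : fderiv ℝ (fun x => coord x) x (EuclideanSpace.single i 1) = 1 := by
    rw [coord.fderiv]
    simp [coord]
  have hsq (x v) : fderiv ℝ (fun x => ψ x ^ 2) x v = 2 * ψ x * fderiv ℝ ψ x v := by
    rw [fderiv_fun_pow 2 (hdiff x)]
    simp
  have hint := integrable_sq_of_hasCompactSupport hψ.continuous hc
  have hcoord_sq : Integrable fun x => coord x * ψ x ^ 2 := by
    have := hψ.continuous
    exact Continuous.integrable_of_hasCompactSupport (by fun_prop)
      (hc.comp_left (g := fun y : ℝ => y ^ 2) (by simp)).mul_left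
  have hparts := integral_mul_fderiv_eq_neg_fderiv_mul_of_integrable (μ := volume)
    (f := fun x => coord x) (g := fun x => ψ x ^ 2) (v := EuclideanSpace.single i 1)
    (by simpa only [hcoord, one_mul] using hint)
    (by simp only [hsq]; exact integrable_coord_mul_fderiv_sq i hψ hc _) hcoord_sq
    (fun _ _ => coord.differentiableAt) (fun x _ => (hdiff x).pow 2)
  simp only [hcoord, one_mul, hsq] at hparts
  exact (neg_eq_iff_eq_neg.2 hparts).symm

theorem neg_mul_mul_le {y z p G : ℝ} (hy : |y| ≤ R) (hp : |p| ≤ G) :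
    -(y * (2 * z * p)) ≤ 1 / 2 * z ^ 2 + 2 * R ^ 2 * G ^ 2 := by
  have hyp : (y * p) ^ 2 ≤ (R * G) ^ 2 := by
    rw [sq_le_sq, abs_mul, abs_mul]
    exact mul_le_mul (hy.trans (le_abs_self R)) (hp.trans (le_abs_self G)) (abs_nonneg _)
      (abs_nonneg _)
  nlinarith [sq_nonneg (z + 2 * (y * p))]

theorem integral_sq_le_integral_norm_gradient_sq (i : Fin d) (hψ : ContDiff ℝ 1 ψ)
    (hc : HasCompactSupport ψ) (hR : ∀ x ∈ tsupport ψ, |x i| ≤ R) :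
    ∫ x, ψ x ^ 2 ≤ 4 * R ^ 2 * ∫ x, ‖gradient ψ x‖ ^ 2 := by
  have hint := integrable_sq_of_hasCompactSupport hψ.continuous hc
  have hgrad := integrable_norm_gradient_sq hψ hc
  have hbound : ∫ x, ψ x ^ 2 ≤ ∫ x, (1 / 2 * ψ x ^ 2 + 2 * R ^ 2 * ‖gradient ψ x‖ ^ 2) := by
    rw [integral_sq_eq_neg_integral_coord_mul i hψ hc, ← integral_neg]
    refine integral_mono (integrable_coord_mul_fderiv_sq i hψ hc _).neg
      ((hint.const_mul _).add (hgrad.const_mul _)) fun x => ?_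
    by_cases hx : x ∈ tsupport ψ
    · refine neg_mul_mul_le (hR x hx) ?_
      simpa [norm_gradient] using (fderiv ℝ ψ x).le_opNorm (EuclideanSpace.single i 1)
    · simp only [image_eq_zero_of_notMem_tsupport hx, mul_zero, zero_mul, neg_zero]
      positivity
  rw [integral_add (hint.const_mul _) (hgrad.const_mul _), integral_const_mul, integral_const_mul]
    at hbound
  linarith

theorem norm_sq_eq_integral_of_ae_eq {X F : Type*} [MeasurableSpace X] {μ : Measure X} {s : Set X}
    [NormedAddCommGroup F] [InnerProductSpace ℝ F] {p : Lp F 2 (μ.restrict s)} {ψ : X → F}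
    (hp : p =ᵐ[μ.restrict s] ψ) (hs : Function.support ψ ⊆ s) :
    ‖p‖ ^ 2 = ∫ x, ‖ψ x‖ ^ 2 ∂μ := by
  have hint : ∫ x, ‖ψ x‖ ^ 2 ∂μ = ∫ x in s, ‖ψ x‖ ^ 2 ∂μ := by
    refine (setIntegral_eq_integral_of_forall_compl_eq_zero fun x hx => ?_).symm
    simp [Function.notMem_support.1 fun h => hx (hs h)]
  rw [← real_inner_self_eq_norm_sq, L2.inner_def, hint]
  refine integral_congr_ae ?_
  filter_upwards [hp] with x hx
  rw [hx, real_inner_self_eq_norm_sq]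

/-- The pairs `(ψ, ∇ψ)` with `ψ ∈ C_c^∞(Ω)`; they already form a subspace, whose closure is
`H10Sub Ω`. -/
def testPairs (Ω : Set (EuclideanSpace ℝ (Fin d))) : Submodule ℝ (WithLp 2 (L2 Ω × L2Vec Ω)) where
  carrier := {p | ∃ ψ : EuclideanSpace ℝ (Fin d) → ℝ,
    ContDiff ℝ ∞ ψ ∧ HasCompactSupport ψ ∧ tsupport ψ ⊆ Ω ∧
    p.fst =ᵐ[volume.restrict Ω] ψ ∧ p.snd =ᵐ[volume.restrict Ω] gradient ψ}
  zero_mem' := by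
    refine ⟨0, contDiff_const, HasCompactSupport.zero, by simp [tsupport],
      Lp.coeFn_zero _ _ _, ?_⟩
    have hgrad : gradient (0 : EuclideanSpace ℝ (Fin d) → ℝ) = 0 := by
      funext x
      simp [gradient]
    rw [hgrad]
    exact Lp.coeFn_zero _ _ _
  add_mem' := by
    rintro p p' ⟨ψ, hψ, hc, hΩ, hfst, hsnd⟩ ⟨ψ', hψ', hc', hΩ', hfst', hsnd'⟩
    refine ⟨ψ + ψ', hψ.add hψ', hc.add hc', (tsupport_add ψ ψ').trans (union_subset hΩ hΩ'), ?_, ?_⟩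
    · filter_upwards [Lp.coeFn_add p.fst p'.fst, hfst, hfst'] with x hadd hx hx'
      rw [WithLp.add_fst, hadd, Pi.add_apply, Pi.add_apply, hx, hx']
    · filter_upwards [Lp.coeFn_add p.snd p'.snd, hsnd, hsnd'] with x hadd hx hx'
      rw [WithLp.add_snd, hadd, Pi.add_apply, hx, hx', gradient, gradient, gradient, ← map_add,
        fderiv_add (hψ.differentiable (by simp) x) (hψ'.differentiable (by simp) x)]
  smul_mem' := by
    rintro c p ⟨ψ, hψ, hc, hΩ, hfst, hsnd⟩
    refine ⟨c • ψ, hψ.const_smul c, hc.smul_left (f := fun _ => c),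
      (tsupport_smul_subset_right (fun _ => c) ψ).trans hΩ, ?_, ?_⟩
    · filter_upwards [Lp.coeFn_smul c p.fst, hfst] with x hsmul hx
      rw [WithLp.smul_fst, hsmul, Pi.smul_apply, Pi.smul_apply, hx]
    · filter_upwards [Lp.coeFn_smul c p.snd, hsnd] with x hsmul hx
      rw [WithLp.smul_snd, hsmul, Pi.smul_apply, hx, gradient, gradient,
        fderiv_const_smul (hψ.differentiable (by simp) x)]
      simp

theorem H10Sub_eq_topologicalClosure_testPairs (Ω : Set (EuclideanSpace ℝ (Fin d))) :
    H10Sub Ω = (testPairs Ω).topologicalClosure :=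
  congrArg Submodule.topologicalClosure (Submodule.span_eq (testPairs Ω))

theorem norm_fst_sq_le_of_mem_testPairs (i : Fin d) (hR : ∀ x ∈ Ω, ‖x‖ ≤ R)
    {p : WithLp 2 (L2 Ω × L2Vec Ω)} (hp : p ∈ testPairs Ω) :
    ‖p.fst‖ ^ 2 ≤ 4 * R ^ 2 * ‖p.snd‖ ^ 2 := by
  obtain ⟨ψ, hψ, hc, hΩ, hfst, hsnd⟩ := hp
  rw [norm_sq_eq_integral_of_ae_eq hfst ((subset_tsupport ψ).trans hΩ),
    norm_sq_eq_integral_of_ae_eq hsnd ((support_gradient_subset ψ).trans hΩ)]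
  simpa using integral_sq_le_integral_norm_gradient_sq i (hψ.of_le (by simp)) hc
    fun x hx => (PiLp.norm_apply_le x i).trans (hR x (hΩ hx))

theorem exists_poincare (hd : 1 ≤ d) (hΩ : Bornology.IsBounded Ω) :
    ∃ C : ℝ, 0 < C ∧ ∀ w : H10 Ω, ‖w.val‖ ^ 2 ≤ C * ‖w.grad‖ ^ 2 := by
  obtain ⟨R, hR0, hR⟩ := hΩ.exists_pos_norm_le
  refine ⟨4 * R ^ 2, by positivity, fun w => ?_⟩
  have hclosed : IsClosed {p : WithLp 2 (L2 Ω × L2Vec Ω) |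
      ‖p.fst‖ ^ 2 ≤ 4 * R ^ 2 * ‖p.snd‖ ^ 2} :=
    isClosed_le ((WithLp.fstL 2 ℝ (L2 Ω) (L2Vec Ω)).continuous.norm.pow 2)
      (((WithLp.sndL 2 ℝ (L2 Ω) (L2Vec Ω)).continuous.norm.pow 2).const_mul _)
  have hw : H10.incl Ω w ∈ (testPairs Ω).topologicalClosure :=
    (H10Sub_eq_topologicalClosure_testPairs Ω).le (Subtype.property (p := (· ∈ H10Sub Ω)) w)
  exact closure_minimal (fun _ => norm_fst_sq_le_of_mem_testPairs ⟨0, hd⟩ hR) hclosed hw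

theorem IsConvexPolytopeDomain.isBounded (hΩ : IsConvexPolytopeDomain Ω) :
    Bornology.IsBounded Ω := by
  obtain ⟨-, S, rfl⟩ := hΩ
  exact (isBounded_convexHull.2 S.finite_toSet.isBounded).subset interior_subset

end Poincare

/-! ### Orthonormal series in the dual of a Hilbert space -/

section Dual

variable {ι H : Type*} [NormedAddCommGroup H] [InnerProductSpace ℝ H] [CompleteSpace H]
  {e : ι → H} {c : ι → ℝ}

theorem summable_smul_innerSL (he : Orthonormal ℝ e)
    (hc : Summable fun j => c j ^ 2) : Summable fun j => c j • innerSL ℝ (e j) := by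
  have hsum : Summable fun j => c j • e j := by
    simpa using (he.orthogonalFamily.summable_iff_norm_sq_summable c).2 (by simpa using hc)
  simpa [Function.comp_def] using
    hsum.map (innerSL ℝ : H →L⋆[ℝ] H →L[ℝ] ℝ) (innerSL ℝ).continuous

theorem tsum_smul_innerSL_apply (he : Orthonormal ℝ e)
    (hc : Summable fun j => c j ^ 2) (i : ι) : (∑' j, c j • innerSL ℝ (e j)) (e i) = c i := by
  classical
  have hsum := (summable_smul_innerSL he hc).hasSum.mapL (ContinuousLinearMap.apply ℝ ℝ (e i))
  have hterm (j : ι) : ContinuousLinearMap.apply ℝ ℝ (e i) (c j • innerSL ℝ (e j)) =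
      if j = i then c i else 0 := by
    rw [ContinuousLinearMap.apply_apply, smul_apply, innerSL_apply_apply,
      orthonormal_iff_ite.1 he j i]
    split_ifs with h <;> simp [h]
  simp only [hterm] at hsum
  exact hsum.unique (hasSum_ite_eq i (c i))

theorem norm_sq_tsum_smul_innerSL (he : Orthonormal ℝ e)
    (hc : Summable fun j => c j ^ 2) :
    ‖∑' j, c j • innerSL ℝ (e j)‖ ^ 2 = ∑' j, c j ^ 2 := by
  refine tendsto_nhds_unique ((summable_smul_innerSL he hc).hasSum.norm.pow 2)
    (hc.hasSum.congr fun s => ?_)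
  have hpartial : ∑ j ∈ s, c j • innerSL ℝ (e j) = innerSL ℝ (∑ j ∈ s, c j • e j) := by
    simp [map_sum]
  have hnorm := he.orthogonalFamily.norm_sum c s
  simp only [LinearIsometry.toSpanSingleton_apply, Real.norm_eq_abs, sq_abs] at hnorm
  rw [hpartial, innerSL_apply_norm, hnorm]

variable (e) in
/-- Restriction of functionals to the closed span of `e`, extended by zero. Its range consists of
the functionals that are determined by their values on `e`. -/
def spanProj : StrongDual ℝ H →L[ℝ] StrongDual ℝ H :=
  (ContinuousLinearMap.compL ℝ H H ℝ).flip
    (Submodule.span ℝ (range e)).topologicalClosure.starProjection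

theorem spanProj_apply (v : StrongDual ℝ H) (x : H) : spanProj e v x =
    v ((Submodule.span ℝ (range e)).topologicalClosure.starProjection x) := rfl

theorem spanProj_innerSL (j : ι) :
    spanProj e (innerSL ℝ (e j)) = innerSL ℝ (e j) := by
  ext x
  rw [spanProj_apply, innerSL_apply_apply, innerSL_apply_apply,
    ← Submodule.inner_starProjection_left_eq_right, Submodule.starProjection_eq_self_iff.2]
  exact Submodule.le_topologicalClosure _ (Submodule.subset_span ⟨j, rfl⟩)

theorem eq_of_spanProj_eq_self {v w : StrongDual ℝ H} (hv : spanProj e v = v)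
    (hw : spanProj e w = w) (hvw : ∀ j, v (e j) = w (e j)) : v = w := by
  have hle : (Submodule.span ℝ (range e)).topologicalClosure ≤ (v - w).ker := by
    refine Submodule.topologicalClosure_minimal _ (Submodule.span_le.2 ?_)
      (ContinuousLinearMap.isClosed_ker _)
    rintro _ ⟨j, rfl⟩
    simp [hvw j]
  ext x
  rw [← hv, ← hw, spanProj_apply, spanProj_apply]
  simpa [sub_eq_zero] using hle (Submodule.starProjection_apply_mem _ x)

end Dual

/-! ### Young's inequality in `L²` -/

section Young

theorem sq_lintegral_mul_le {Y : Type*} [MeasurableSpace Y] {μ : Measure Y} {κ ν : Y → ℝ≥0∞}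
    (hκ : AEMeasurable κ μ) (hν : AEMeasurable ν μ) :
    (∫⁻ s, κ s * ν s ∂μ) ^ 2 ≤ (∫⁻ s, κ s ∂μ) * ∫⁻ s, κ s * ν s ^ 2 ∂μ := by
  have hsqrt_mul (y : ℝ≥0∞) : y ^ (1 / 2 : ℝ) * y ^ (1 / 2 : ℝ) = y := by
    rw [← ENNReal.rpow_add_of_nonneg _ _ (by norm_num) (by norm_num)]
    norm_num
  have hsqrt_sq (y : ℝ≥0∞) : (y ^ (1 / 2 : ℝ)) ^ (2 : ℝ) = y := by
    rw [← ENNReal.rpow_mul]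
    norm_num
  have hHolder := ENNReal.lintegral_mul_le_Lp_mul_Lq μ Real.HolderConjugate.two_two
    (f := fun s => κ s ^ (1 / 2 : ℝ)) (g := fun s => κ s ^ (1 / 2 : ℝ) * ν s)
    (by fun_prop) (by fun_prop)
  simp only [Pi.mul_apply, ← mul_assoc, hsqrt_mul, ENNReal.mul_rpow_of_nonneg _ _ zero_le_two,
    hsqrt_sq] at hHolder
  refine (pow_le_pow_left₀ zero_le hHolder 2).trans_eq ?_
  rw [mul_pow, ← ENNReal.rpow_two, ← ENNReal.rpow_two, hsqrt_sq, hsqrt_sq]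
  simp only [ENNReal.rpow_two]

theorem lintegral_sq_conv_le {G : Type*} [AddCommGroup G] [MeasurableSpace G] [MeasurableAdd₂ G]
    [MeasurableNeg G] {μ : Measure G} [SFinite μ] [μ.IsAddLeftInvariant] [μ.IsNegInvariant]
    {κ ν : G → ℝ≥0∞} (hκ : AEMeasurable κ μ) (hν : AEMeasurable ν μ) :
    ∫⁻ t, (∫⁻ s, κ (t - s) * ν s ∂μ) ^ 2 ∂μ ≤ (∫⁻ s, κ s ∂μ) ^ 2 * ∫⁻ s, ν s ^ 2 ∂μ := by
  have hκ_sub (t : G) : AEMeasurable (fun s => κ (t - s)) μ :=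
    hκ.comp_quasiMeasurePreserving (quasiMeasurePreserving_sub_left_of_right_invariant _ t)
  have hκν : AEMeasurable (Function.uncurry fun t s : G => κ (t - s) * ν s ^ 2) (μ.prod μ) :=
    (hκ.comp_quasiMeasurePreserving (quasiMeasurePreserving_sub_of_right_invariant _ _)).mul
      (hν.comp_snd.pow_const 2)
  calc ∫⁻ t, (∫⁻ s, κ (t - s) * ν s ∂μ) ^ 2 ∂μ
      ≤ ∫⁻ t, (∫⁻ s, κ s ∂μ) * ∫⁻ s, κ (t - s) * ν s ^ 2 ∂μ ∂μ := lintegral_mono fun t => by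
        simpa only [lintegral_sub_left_eq_self] using sq_lintegral_mul_le (hκ_sub t) hν
    _ = (∫⁻ s, κ s ∂μ) * ∫⁻ s, ∫⁻ t, κ (t - s) * ν s ^ 2 ∂μ ∂μ := by
        rw [← lintegral_lintegral_swap hκν]
        exact lintegral_const_mul'' _ hκν.lintegral_prod_right'
    _ = (∫⁻ s, κ s ∂μ) * ∫⁻ s, (∫⁻ t, κ t ∂μ) * ν s ^ 2 ∂μ := by
        congr 1
        refine lintegral_congr fun s => ?_
        have hκ_shift : AEMeasurable (fun t => κ (t - s)) μ := hκ.comp_quasiMeasurePreserving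
          (measurePreserving_sub_right μ s).quasiMeasurePreserving
        rw [lintegral_mul_const'' _ hκ_shift, lintegral_sub_right_eq_self]
    _ = (∫⁻ s, κ s ∂μ) ^ 2 * ∫⁻ s, ν s ^ 2 ∂μ := by
        rw [lintegral_const_mul'' _ (by fun_prop), sq, mul_assoc]

theorem lintegral_enorm_causalConv_sq_le {X : Type*} [NormedAddCommGroup X] [NormedSpace ℝ X]
    {k : ℝ → ℝ} {v : ℝ → X} {T : ℝ} (hk : AEStronglyMeasurable k (volume.restrict (Ioo 0 T)))
    (hv : AEStronglyMeasurable v (volume.restrict (Ioo 0 T))) :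
    ∫⁻ t in Ioo 0 T, ‖causalConv k v t‖ₑ ^ 2 ≤
      (∫⁻ t in Ioo 0 T, ‖k t‖ₑ) ^ 2 * ∫⁻ t in Ioo 0 T, ‖v t‖ₑ ^ 2 := by
  let κ (s : ℝ) : ℝ≥0∞ := ‖(Ioo 0 T).indicator k s‖ₑ
  let ν (s : ℝ) : ℝ≥0∞ := ‖(Ioo 0 T).indicator v s‖ₑ
  have hκ : AEMeasurable κ := ((aestronglyMeasurable_indicator_iff measurableSet_Ioo).2 hk).enorm
  have hν : AEMeasurable ν := ((aestronglyMeasurable_indicator_iff measurableSet_Ioo).2 hv).enorm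
  have hκ_eq : ∫⁻ s, κ s = ∫⁻ t in Ioo 0 T, ‖k t‖ₑ := by
    simp only [κ, enorm_indicator_eq_indicator_enorm, lintegral_indicator measurableSet_Ioo]
  have hν_eq : ∫⁻ s, ν s ^ 2 = ∫⁻ t in Ioo 0 T, ‖v t‖ₑ ^ 2 := by
    rw [← lintegral_indicator measurableSet_Ioo]
    refine lintegral_congr fun s => ?_
    by_cases hs : s ∈ Ioo 0 T <;> simp [ν, hs]
  rw [← hκ_eq, ← hν_eq]
  refine le_trans ?_ (lintegral_sq_conv_le hκ hν)
  refine (setLIntegral_mono' measurableSet_Ioo fun t ht => ?_).trans (setLIntegral_le_lintegral _ _)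
  rw [causalConv_eq_convolution k v ht.2.le, convolution_eq_swap]
  refine pow_le_pow_left₀ zero_le ((enorm_integral_le_lintegral_enorm _).trans_eq ?_) 2
  simp only [ContinuousLinearMap.lsmul_apply, enorm_smul, κ, ν]

end Young

/-! ### Eigenfunction expansions in `H⁻¹(Ω)` -/

section Eigen

variable {d : ℕ} {Ω : Set (EuclideanSpace ℝ (Fin d))} {lam : ℕ → ℝ} {φ : ℕ → H10 Ω}

instance : CompleteSpace (H10 Ω) :=
  (Submodule.isClosed_topologicalClosure _).completeSpace_coe

theorem H10.inner_eq (v w : H10 Ω) :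
    inner ℝ v w = inner ℝ v.val w.val + inner ℝ v.grad w.grad := rfl

theorem ofL2_apply (g : L2 Ω) (w : H10 Ω) : ofL2 g w = inner ℝ g w.val := rfl

/-- The eigenfunctions, normalized in `H¹₀(Ω)`. -/
def normEigen (lam : ℕ → ℝ) (φ : ℕ → H10 Ω) (j : ℕ) : H10 Ω := (√(1 + lam j))⁻¹ • φ j

/-- The series `∑ⱼ cⱼ φⱼ` in `H⁻¹(Ω)`. -/
def synth (φ : ℕ → H10 Ω) (c : ℕ → ℝ) : Hneg1 Ω := ∑' j, c j • ofL2 (φ j).val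

/-- The coefficient sequences for which `synth` converges: `∑ⱼ cⱼ² / (1 + λⱼ)` is the squared norm
of `∑ⱼ cⱼ φⱼ` in `H⁻¹(Ω)`. -/
abbrev IsHneg1Coef (lam c : ℕ → ℝ) : Prop := Summable fun j => c j ^ 2 / (1 + lam j)

theorem smul_synth (r : ℝ) (c : ℕ → ℝ) : r • synth φ c = synth φ fun j => r * c j := by
  simp only [synth, mul_smul, tsum_const_smul'']

namespace IsDirichletEigensystem

variable (hφ : IsDirichletEigensystem Ω lam φ) {c e : ℕ → ℝ}
include hφ

theorem inner_left (j : ℕ) (w : H10 Ω) :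
    inner ℝ (φ j) w = (1 + lam j) * inner ℝ (φ j).val w.val := by
  rw [H10.inner_eq, hφ.eigen j w]
  ring

theorem eigenvalue_eq (j : ℕ) : lam j = ‖(φ j).grad‖ ^ 2 := by
  have heigen := hφ.eigen j (φ j)
  rw [real_inner_self_eq_norm_sq, real_inner_self_eq_norm_sq, hφ.orthonormal.1 j] at heigen
  rw [heigen]
  ring

theorem eigenvalue_nonneg (j : ℕ) : 0 ≤ lam j := by
  rw [hφ.eigenvalue_eq j]
  positivity

theorem one_add_eigenvalue_pos (j : ℕ) : 0 < 1 + lam j := by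
  linarith [hφ.eigenvalue_nonneg j]

theorem exists_le_eigenvalue (hd : 1 ≤ d) (hΩ : Bornology.IsBounded Ω) :
    ∃ c₀ > 0, ∀ j, c₀ ≤ lam j := by
  obtain ⟨C, hC, hpoincare⟩ := exists_poincare hd hΩ
  refine ⟨C⁻¹, inv_pos.2 hC, fun j => ?_⟩
  have hj := hpoincare (φ j)
  rw [hφ.orthonormal.1 j, ← hφ.eigenvalue_eq j, one_pow] at hj
  rwa [inv_le_iff_one_le_mul₀' hC]

theorem orthonormal_normEigen : Orthonormal ℝ (normEigen lam φ) := by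
  rw [orthonormal_iff_ite]
  intro i j
  rw [normEigen, normEigen, real_inner_smul_left, real_inner_smul_right, hφ.inner_left,
    orthonormal_iff_ite.1 hφ.orthonormal i j]
  split_ifs with hij
  · subst hij
    have hi := hφ.one_add_eigenvalue_pos i
    have hsqrt : √(1 + lam i) ≠ 0 := (Real.sqrt_pos.2 hi).ne'
    field_simp [hsqrt]
    rw [Real.sq_sqrt hi.le]
  · simp

theorem smul_ofL2_eq (r : ℝ) (j : ℕ) :
    r • ofL2 (φ j).val = (r * (√(1 + lam j))⁻¹) • innerSL ℝ (normEigen lam φ j) := by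
  have hj := hφ.one_add_eigenvalue_pos j
  ext w
  rw [smul_apply, ofL2_apply, smul_apply, innerSL_apply_apply, normEigen, real_inner_smul_left,
    hφ.inner_left, smul_eq_mul, smul_eq_mul]
  have hsqrt : √(1 + lam j) ≠ 0 := (Real.sqrt_pos.2 hj).ne'
  field_simp [hsqrt]
  rw [Real.sq_sqrt hj.le]

theorem mul_inv_sqrt_sq (r : ℝ) (j : ℕ) :
    (r * (√(1 + lam j))⁻¹) ^ 2 = r ^ 2 / (1 + lam j) := by
  rw [mul_pow, inv_pow, Real.sq_sqrt (hφ.one_add_eigenvalue_pos j).le, div_eq_mul_inv]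

theorem summable_synth (hc : IsHneg1Coef lam c) : Summable fun j => c j • ofL2 (φ j).val := by
  simp only [hφ.smul_ofL2_eq]
  exact summable_smul_innerSL hφ.orthonormal_normEigen (by simpa only [hφ.mul_inv_sqrt_sq] using hc)

theorem norm_sq_synth (hc : IsHneg1Coef lam c) :
    ‖synth φ c‖ ^ 2 = ∑' j, c j ^ 2 / (1 + lam j) := by
  simp only [synth, hφ.smul_ofL2_eq]
  rw [norm_sq_tsum_smul_innerSL hφ.orthonormal_normEigen
    (by simpa only [hφ.mul_inv_sqrt_sq] using hc)]
  simp only [hφ.mul_inv_sqrt_sq]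

theorem synth_apply (hc : IsHneg1Coef lam c) (i : ℕ) : synth φ c (φ i) = c i := by
  have hsqrt : √(1 + lam i) ≠ 0 := (Real.sqrt_pos.2 (hφ.one_add_eigenvalue_pos i)).ne'
  have hφi : φ i = √(1 + lam i) • normEigen lam φ i := by
    rw [normEigen, smul_smul, mul_inv_cancel₀ hsqrt, one_smul]
  rw [hφi, map_smul]
  simp only [synth, hφ.smul_ofL2_eq]
  rw [tsum_smul_innerSL_apply hφ.orthonormal_normEigen
    (by simpa only [hφ.mul_inv_sqrt_sq] using hc), smul_eq_mul]
  field_simp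

theorem spanProj_synth (hc : IsHneg1Coef lam c) :
    spanProj (normEigen lam φ) (synth φ c) = synth φ c := by
  rw [synth, ContinuousLinearMap.map_tsum _ (hφ.summable_synth hc)]
  refine tsum_congr fun j => ?_
  rw [hφ.smul_ofL2_eq, map_smul, spanProj_innerSL]

theorem div_one_add_le_of_abs_le {A : ℝ} (hce : ∀ j, |c j| ≤ A * |e j|) (j : ℕ) :
    c j ^ 2 / (1 + lam j) ≤ A ^ 2 * (e j ^ 2 / (1 + lam j)) := by
  have := hφ.one_add_eigenvalue_pos j
  rw [← mul_div_assoc, ← sq_abs (c j), ← sq_abs (e j), ← mul_pow]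
  gcongr
  exact hce j

theorem isHneg1Coef_of_abs_le {A : ℝ} (he : IsHneg1Coef lam e) (hce : ∀ j, |c j| ≤ A * |e j|) :
    IsHneg1Coef lam c :=
  Summable.of_nonneg_of_le
    (fun j => div_nonneg (sq_nonneg _) (hφ.one_add_eigenvalue_pos j).le)
    (hφ.div_one_add_le_of_abs_le hce) (he.mul_left (A ^ 2))

theorem norm_synth_le {A : ℝ} (hA : 0 ≤ A) (he : IsHneg1Coef lam e)
    (hce : ∀ j, |c j| ≤ A * |e j|) : ‖synth φ c‖ ≤ A * ‖synth φ e‖ := by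
  have hc := hφ.isHneg1Coef_of_abs_le he hce
  refine le_of_sq_le_sq ?_ (by positivity)
  rw [hφ.norm_sq_synth hc, mul_pow, hφ.norm_sq_synth he, ← tsum_mul_left]
  exact hc.tsum_le_tsum (hφ.div_one_add_le_of_abs_le hce) (he.mul_left _)

section Integral

variable {Y : Type*} [MeasurableSpace Y] {μ : Measure Y} {c e : Y → ℕ → ℝ}

theorem aestronglyMeasurable_synth (hmeas : ∀ j, AEStronglyMeasurable (fun y => c y j) μ)
    (hc : ∀ᵐ y ∂μ, IsHneg1Coef lam (c y)) : AEStronglyMeasurable (fun y => synth φ (c y)) μ := by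
  refine aestronglyMeasurable_of_tendsto_ae Filter.atTop
    (f := fun n y => ∑ j ∈ Finset.range n, c y j • ofL2 (φ j).val)
    (fun n => Finset.aestronglyMeasurable_fun_sum _ fun j _ => (hmeas j).smul_const _) ?_
  filter_upwards [hc] with y hy
  exact (hφ.summable_synth hy).hasSum.tendsto_sum_nat

theorem integrable_coef (hc : ∀ᵐ y ∂μ, IsHneg1Coef lam (c y))
    (hint : Integrable (fun y => synth φ (c y)) μ) (j : ℕ) : Integrable (fun y => c y j) μ := by
  refine ((ContinuousLinearMap.apply ℝ ℝ (φ j)).integrable_comp hint).congr ?_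
  filter_upwards [hc] with y hy
  exact hφ.synth_apply hy j

theorem integral_synth_apply (hc : ∀ᵐ y ∂μ, IsHneg1Coef lam (c y))
    (hint : Integrable (fun y => synth φ (c y)) μ) (j : ℕ) :
    (∫ y, synth φ (c y) ∂μ) (φ j) = ∫ y, c y j ∂μ := by
  rw [ContinuousLinearMap.integral_apply hint]
  refine integral_congr_ae ?_
  filter_upwards [hc] with y hy
  exact hφ.synth_apply hy j

theorem spanProj_integral_synth (hc : ∀ᵐ y ∂μ, IsHneg1Coef lam (c y))
    (hint : Integrable (fun y => synth φ (c y)) μ) :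
    spanProj (normEigen lam φ) (∫ y, synth φ (c y) ∂μ) = ∫ y, synth φ (c y) ∂μ := by
  rw [← ContinuousLinearMap.integral_comp_comm _ hint]
  refine integral_congr_ae ?_
  filter_upwards [hc] with y hy
  exact hφ.spanProj_synth hy

theorem integral_synth_eq_integral_synth (hc : ∀ᵐ y ∂μ, IsHneg1Coef lam (c y))
    (hint_c : Integrable (fun y => synth φ (c y)) μ) (he : ∀ᵐ y ∂μ, IsHneg1Coef lam (e y))
    (hint_e : Integrable (fun y => synth φ (e y)) μ)
    (hce : ∀ j, ∫ y, c y j ∂μ = ∫ y, e y j ∂μ) :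
    ∫ y, synth φ (c y) ∂μ = ∫ y, synth φ (e y) ∂μ := by
  refine eq_of_spanProj_eq_self (hφ.spanProj_integral_synth hc hint_c)
    (hφ.spanProj_integral_synth he hint_e) fun j => ?_
  rw [normEigen, map_smul, map_smul, hφ.integral_synth_apply hc hint_c,
    hφ.integral_synth_apply he hint_e, hce]

end Integral

end IsDirichletEigensystem

end Eigen

/-! ### The embedding of `Ḣ^q(Ω)` in `H⁻¹(Ω)` -/

section Embedding

variable {d : ℕ} {Ω : Set (EuclideanSpace ℝ (Fin d))} {lam : ℕ → ℝ} {φ : ℕ → H10 Ω}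

theorem inv_one_add_le_mul_rpow {c₀ x q : ℝ} (hc₀ : 0 < c₀) (hx : c₀ ≤ x) (hq : -1 ≤ q) :
    (1 + x)⁻¹ ≤ (c₀ ^ (q + 1))⁻¹ * x ^ q := by
  have hx0 : 0 < x := hc₀.trans_le hx
  have hc₀q : 0 < c₀ ^ (q + 1) := Real.rpow_pos_of_pos hc₀ _
  have hxq : 0 < x ^ q := Real.rpow_pos_of_pos hx0 _
  have hrpow : c₀ ^ (q + 1) ≤ x ^ q * x := by
    rw [← Real.rpow_add_one hx0.ne']
    exact Real.rpow_le_rpow hc₀.le hx (by linarith)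
  rw [inv_mul_eq_div, inv_eq_one_div, div_le_div_iff₀ (by positivity) hc₀q]
  linarith

/-- The squared norm in `L²(0,T;Ḣˢ(Ω))` of the function with coefficients `c`; the argument of `c`
is time, its index the number of the eigenvalue. -/
def coefSq (lam : ℕ → ℝ) (s T : ℝ) (c : ℝ → ℕ → ℝ) : ℝ≥0∞ :=
  ∫⁻ t in Ioo 0 T, ∑' j, ENNReal.ofReal (lam j ^ s * c t j ^ 2)

/-- The coefficients `c` belong to a function in `L²(0,T;Ḣˢ(Ω))`. -/
structure MemL2Coef (lam : ℕ → ℝ) (s T : ℝ) (c : ℝ → ℕ → ℝ) : Prop where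
  aestronglyMeasurable (j : ℕ) : AEStronglyMeasurable (fun t => c t j) (volume.restrict (Ioo 0 T))
  coefSq_lt_top : coefSq lam s T c < ⊤

variable {q s t T : ℝ} {c e : ℝ → ℕ → ℝ}

theorem coefSq_eq_tsum
    (hc : ∀ j, AEStronglyMeasurable (fun t => c t j) (volume.restrict (Ioo 0 T))) :
    coefSq lam s T c =
      ∑' j, ENNReal.ofReal (lam j ^ s) * ∫⁻ t in Ioo 0 T, ‖c t j‖ₑ ^ 2 := by
  have hterm (t : ℝ) (j : ℕ) : ENNReal.ofReal (lam j ^ s * c t j ^ 2) =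
      ENNReal.ofReal (lam j ^ s) * ‖c t j‖ₑ ^ 2 := by
    rw [ENNReal.ofReal_mul' (sq_nonneg _), ← sq_abs, ENNReal.ofReal_pow (abs_nonneg _),
      Real.enorm_eq_ofReal_abs]
  simp only [coefSq, hterm]
  rw [lintegral_tsum fun j => ((hc j).enorm.pow_const 2).const_mul _]
  simp only [fun j => lintegral_const_mul'' (ENNReal.ofReal (lam j ^ s)) ((hc j).enorm.pow_const 2)]

theorem coefSq_le_mul {A : ℝ≥0∞}
    (hc : ∀ j, AEStronglyMeasurable (fun t => c t j) (volume.restrict (Ioo 0 T)))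
    (he : ∀ j, AEStronglyMeasurable (fun t => e t j) (volume.restrict (Ioo 0 T)))
    (hce : ∀ j, ∫⁻ t in Ioo 0 T, ‖c t j‖ₑ ^ 2 ≤ A * ∫⁻ t in Ioo 0 T, ‖e t j‖ₑ ^ 2) :
    coefSq lam s T c ≤ A * coefSq lam s T e := by
  rw [coefSq_eq_tsum hc, coefSq_eq_tsum he, ← ENNReal.tsum_mul_left]
  refine ENNReal.tsum_le_tsum fun j => ?_
  rw [mul_left_comm]
  gcongr
  exact hce j

theorem coefSq_add_two (hlam : ∀ j, 0 < lam j) (s T : ℝ) (c : ℝ → ℕ → ℝ) :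
    coefSq lam (s + 2) T c = coefSq lam s T fun t j => lam j * c t j := by
  simp only [coefSq, Real.rpow_add (hlam _), Real.rpow_two, mul_pow, mul_assoc]

theorem normL2DotH_le_mul {u f : ℝ → Hneg1 Ω} {A : ℝ≥0∞}
    (hu : ∀ᵐ t ∂volume.restrict (Ioo 0 T), ∀ j, u t (φ j) = c t j)
    (hc : coefSq lam s T c ≤ A ^ 2 * coefSq lam q T fun t j => f t (φ j)) :
    normL2DotH lam φ s T u ≤ A * normL2DotH lam φ q T f := by
  have hcoef : ∫⁻ t in Ioo 0 T, dotHSq lam φ s (u t) = coefSq lam s T c := by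
    refine lintegral_congr_ae ?_
    filter_upwards [hu] with t ht
    simp only [dotHSq, ht]
  have hA : (A ^ 2) ^ (1 / 2 : ℝ) = A := by
    rw [← ENNReal.rpow_two, ← ENNReal.rpow_mul]
    norm_num
  calc normL2DotH lam φ s T u ≤ (A ^ 2 * coefSq lam q T fun t j => f t (φ j)) ^ (1 / 2 : ℝ) := by
        rw [normL2DotH, hcoef]
        gcongr
    _ = A * normL2DotH lam φ q T f := by
        rw [ENNReal.mul_rpow_of_nonneg _ _ (by norm_num), hA]
        rfl

theorem MemL2DotH.memL2Coef {f : ℝ → Hneg1 Ω} (hf : MemL2DotH lam φ s T f) :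
    MemL2Coef lam s T fun t j => f t (φ j) where
  aestronglyMeasurable j :=
    (ContinuousLinearMap.apply ℝ ℝ (φ j)).continuous.comp_aestronglyMeasurable hf.1
  coefSq_lt_top := (ENNReal.rpow_lt_top_iff_of_pos (by norm_num)).1 hf.2

theorem MemL2Coef.mono (hc : MemL2Coef lam s T c) (ht : t ≤ T) : MemL2Coef lam s t c where
  aestronglyMeasurable j := (hc.aestronglyMeasurable j).mono_set (Ioo_subset_Ioo_right ht)
  coefSq_lt_top := (lintegral_mono_set (Ioo_subset_Ioo_right ht)).trans_lt hc.coefSq_lt_top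

theorem MemL2DotH.mono {f : ℝ → Hneg1 Ω} (hf : MemL2DotH lam φ s T f) (ht : t ≤ T) :
    MemL2DotH lam φ s t f :=
  ⟨hf.1.mono_set (Ioo_subset_Ioo_right ht), lt_of_le_of_lt (ENNReal.rpow_le_rpow
    (lintegral_mono_set (Ioo_subset_Ioo_right ht)) (by norm_num)) hf.2⟩

namespace IsDirichletEigensystem

variable (hφ : IsDirichletEigensystem Ω lam φ) {M : ℝ}
include hφ

theorem tsum_div_one_add_le (hM : ∀ j, (1 + lam j)⁻¹ ≤ M * lam j ^ q) (c : ℕ → ℝ) :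
    ∑' j, ENNReal.ofReal (c j ^ 2 / (1 + lam j)) ≤
      ENNReal.ofReal M * ∑' j, ENNReal.ofReal (lam j ^ q * c j ^ 2) := by
  rw [← ENNReal.tsum_mul_left]
  refine ENNReal.tsum_le_tsum fun j => ?_
  rw [← ENNReal.ofReal_mul'
    (mul_nonneg (Real.rpow_nonneg (hφ.eigenvalue_nonneg j) q) (sq_nonneg _)), ← mul_assoc,
    div_eq_inv_mul]
  exact ENNReal.ofReal_le_ofReal (mul_le_mul_of_nonneg_right (hM j) (sq_nonneg _))

theorem isHneg1Coef_of_tsum_lt_top (hM : ∀ j, (1 + lam j)⁻¹ ≤ M * lam j ^ q) {c : ℕ → ℝ}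
    (hc : ∑' j, ENNReal.ofReal (lam j ^ q * c j ^ 2) < ⊤) : IsHneg1Coef lam c := by
  have hlt := (hφ.tsum_div_one_add_le hM c).trans_lt (ENNReal.mul_lt_top ENNReal.ofReal_lt_top hc)
  refine (ENNReal.summable_toReal hlt.ne).congr fun j => ENNReal.toReal_ofReal ?_
  exact div_nonneg (sq_nonneg _) (hφ.one_add_eigenvalue_pos j).le

theorem enorm_synth_sq_le (hM : ∀ j, (1 + lam j)⁻¹ ≤ M * lam j ^ q) {c : ℕ → ℝ}
    (hc : IsHneg1Coef lam c) : ‖synth φ c‖ₑ ^ 2 ≤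
      ENNReal.ofReal M * ∑' j, ENNReal.ofReal (lam j ^ q * c j ^ 2) := by
  rw [← ofReal_norm, ← ENNReal.ofReal_pow (norm_nonneg _), hφ.norm_sq_synth hc,
    ENNReal.ofReal_tsum_of_nonneg
      (fun j => div_nonneg (sq_nonneg _) (hφ.one_add_eigenvalue_pos j).le) hc]
  exact hφ.tsum_div_one_add_le hM c

theorem ae_isHneg1Coef (hM : ∀ j, (1 + lam j)⁻¹ ≤ M * lam j ^ q) (hc : MemL2Coef lam q T c) :
    ∀ᵐ t ∂volume.restrict (Ioo 0 T), IsHneg1Coef lam (c t) := by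
  have hmeas : AEMeasurable (fun t => ∑' j, ENNReal.ofReal (lam j ^ q * c t j ^ 2))
      (volume.restrict (Ioo 0 T)) := AEMeasurable.tsum fun j =>
    (((hc.aestronglyMeasurable j).aemeasurable.pow_const 2).const_mul _).ennreal_ofReal
  filter_upwards [ae_lt_top' hmeas hc.coefSq_lt_top.ne] with t ht
  exact hφ.isHneg1Coef_of_tsum_lt_top hM ht

theorem ae_synth_apply (hM : ∀ j, (1 + lam j)⁻¹ ≤ M * lam j ^ q) (hc : MemL2Coef lam q T c) :
    ∀ᵐ t ∂volume.restrict (Ioo 0 T), ∀ j, synth φ (c t) (φ j) = c t j :=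
  (hφ.ae_isHneg1Coef hM hc).mono fun _ => hφ.synth_apply

theorem integrableOn_synth (hM : ∀ j, (1 + lam j)⁻¹ ≤ M * lam j ^ q)
    (hc : MemL2Coef lam q T c) : IntegrableOn (fun t => synth φ (c t)) (Ioo 0 T) := by
  have hcoef := hφ.ae_isHneg1Coef hM hc
  refine MemLp.integrable (q := 2) (by norm_num)
    ⟨hφ.aestronglyMeasurable_synth hc.aestronglyMeasurable hcoef, ?_⟩
  rw [eLpNorm_lt_top_iff_lintegral_rpow_enorm_lt_top (by norm_num) (by norm_num)]
  simp only [ENNReal.toReal_ofNat, ENNReal.rpow_ofNat]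
  calc ∫⁻ t in Ioo 0 T, ‖synth φ (c t)‖ₑ ^ 2
      ≤ ∫⁻ t in Ioo 0 T, ENNReal.ofReal M * ∑' j, ENNReal.ofReal (lam j ^ q * c t j ^ 2) :=
        lintegral_mono_ae (hcoef.mono fun _ => hφ.enorm_synth_sq_le hM)
    _ = ENNReal.ofReal M * coefSq lam q T c := lintegral_const_mul' _ _ ENNReal.ofReal_ne_top
    _ < ⊤ := ENNReal.mul_lt_top ENNReal.ofReal_lt_top hc.coefSq_lt_top

end IsDirichletEigensystem

end Embedding

/-! ### Caputo derivatives of convolutions -/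

section Caputo

variable {X : Type*} [NormedAddCommGroup X] [NormedSpace ℝ X]

theorem hasCaputoDeriv_of_causalConv {γ T : ℝ} (hγ : γ < 1) {u g : ℝ → X}
    (hu : IntegrableOn u (Ioo 0 T)) (hg : IntegrableOn g (Ioo 0 T))
    (hug : ∀ᵐ t ∂volume.restrict (Ioo 0 T),
      causalConv (fracKer (1 - γ)) u t = causalConv (fracKer 1) g t) :
    HasCaputoDeriv γ T u g := by
  have hker : fracKer (1 - γ) = fun r => (Real.Gamma (1 - γ))⁻¹ * r ^ (-γ) := by
    funext r
    rw [fracKer, sub_sub_cancel_left, div_eq_inv_mul]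
  have hpow : IntegrableOn (fun r : ℝ => r ^ (-γ)) (Ioo 0 T) := by
    simpa only [sub_sub_cancel_left] using integrableOn_rpow_sub_one (sub_pos.2 hγ) T
  refine ⟨hu, hg, ?_⟩
  filter_upwards [hug, ae_causalConvExistsAt hpow hu] with t ht hexists
  rw [hker, causalConv_const_mul_left] at ht
  exact ⟨hexists, ht.trans (by simp only [causalConv, fracKer_one, one_smul])⟩

theorem HasCaputoDeriv.congr {γ T : ℝ} {u v g : ℝ → X} (hu : HasCaputoDeriv γ T u g)
    (huv : u =ᵐ[volume.restrict (Ioo 0 T)] v) : HasCaputoDeriv γ T v g := by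
  refine ⟨hu.1.congr huv, hu.2.1, ?_⟩
  filter_upwards [self_mem_ae_restrict measurableSet_Ioo, hu.2.2] with t ht hut
  have hcongr : (fun τ => (t - τ) ^ (-γ) • u τ) =ᵐ[volume.restrict (Ioo 0 t)]
      fun τ => (t - τ) ^ (-γ) • v τ := by
    filter_upwards [ae_restrict_of_ae_restrict_of_subset (Ioo_subset_Ioo_right ht.2.le) huv]
      with τ hτ
    rw [hτ]
  exact ⟨hut.1.congr hcongr, integral_congr_ae hcongr ▸ hut.2⟩

theorem HasMultiTermDeriv.congr {m : ℕ} {α T : ℝ} {a b : Fin m → ℝ} {u v g : ℝ → X}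
    (hu : HasMultiTermDeriv α a b T u g) (huv : u =ᵐ[volume.restrict (Ioo 0 T)] v) :
    HasMultiTermDeriv α a b T v g :=
  let ⟨g₀, gs, hg₀, hgs, hg⟩ := hu
  ⟨g₀, gs, hg₀.congr huv, fun i => (hgs i).congr huv, hg⟩

theorem HasMultiTermDeriv.aestronglyMeasurable {m : ℕ} {α T : ℝ} {a b : Fin m → ℝ} {u g : ℝ → X}
    (hu : HasMultiTermDeriv α a b T u g) : AEStronglyMeasurable u (volume.restrict (Ioo 0 T)) :=
  let ⟨_, _, hg₀, _⟩ := hu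
  hg₀.1.1

variable [CompleteSpace X] {T : ℝ} {v : ℝ → X}

section MlKer

variable {ι : Type*} [Fintype ι] {β : ι → ℝ} {x γ : ℝ}

theorem hasCaputoDeriv_causalConv_mlKer (hβ : ∀ i, 0 < β i) (w : ι → ℝ) (hx : 0 < x) (hγ : γ < 1)
    (hγx : γ < x) (hv : IntegrableOn v (Ioo 0 T)) :
    HasCaputoDeriv γ T (causalConv (mlKer β w x) v) (causalConv (mlKer β w (x - γ)) v) := by
  refine hasCaputoDeriv_of_causalConv hγ
    (integrableOn_causalConv (integrableOn_mlKer hβ hx T) hv)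
    (integrableOn_causalConv (integrableOn_mlKer hβ (sub_pos.2 hγx) T) hv) ?_
  filter_upwards [ae_causalConv_mlKer_add (w := w) hβ hx (sub_pos.2 hγ) hv,
    ae_causalConv_mlKer_add (w := w) hβ (sub_pos.2 hγx) one_pos hv] with t hleft hright
  rw [← hleft, ← hright, sub_add_eq_add_sub, add_sub_assoc]

theorem hasCaputoDeriv_causalConv_mlKer_self (hβ : ∀ i, 0 < β i) (w : ι → ℝ) (hx0 : 0 < x)
    (hx1 : x < 1) (hv : IntegrableOn v (Ioo 0 T)) :
    HasCaputoDeriv x T (causalConv (mlKer β w x) v)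
      (fun t => v t + ∑ i, w i • causalConv (mlKer β w (β i)) v t) := by
  have hint (y : ℝ) (hy : 0 < y) : IntegrableOn (causalConv (mlKer β w y) v) (Ioo 0 T) :=
    integrableOn_causalConv (integrableOn_mlKer hβ hy T) hv
  have hone := integrableOn_fracKer one_pos T
  refine hasCaputoDeriv_of_causalConv hx1 (hint x hx0)
    (hv.add (integrable_finsetSum _ fun i _ => (hint _ (hβ i)).smul (w i))) ?_
  filter_upwards [ae_causalConv_mlKer_add (w := w) hβ hx0 (sub_pos.2 hx1) hv,
    ae_causalConv_mlKer_expand (w := w) hβ one_pos hv,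
    ae_all_iff.2 fun i => ae_causalConv_mlKer_add (w := w) hβ (hβ i) one_pos hv,
    ae_causalConvExistsAt hone hv,
    ae_all_iff.2 fun i => ae_causalConvExistsAt hone (hint _ (hβ i))]
    with t hfrac hexpand hshift hexists hexists_sum
  rw [← hfrac, add_sub_cancel, hexpand,
    causalConv_add_right hexists (.sum_right _ w fun i _ => hexists_sum i),
    causalConv_sum_right _ w fun i _ => hexists_sum i]
  simp only [add_comm (1 : ℝ), hshift]

end MlKer

variable {m : ℕ} {α : ℝ} {a b : Fin m → ℝ}

theorem hasMultiTermDeriv_causalConv_multiKer (hα0 : 0 < α) (hα1 : α < 1) (ha : ∀ i, a i < α)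
    (b : Fin m → ℝ) (μ : ℝ) (hv : IntegrableOn v (Ioo 0 T)) :
    HasMultiTermDeriv α a b T (causalConv (multiKer α a b μ α) v)
      (fun t => v t - μ • causalConv (multiKer α a b μ α) v t) := by
  have hβ := multiExp_pos hα0 ha
  refine ⟨_, fun i => causalConv (multiKer α a b μ (α - a i)) v,
    hasCaputoDeriv_causalConv_mlKer_self hβ _ hα0 hα1 hv,
    fun i => hasCaputoDeriv_causalConv_mlKer hβ _ hα0 ((ha i).trans hα1) (ha i) hv,
    .of_forall fun t => ?_⟩
  simp only [Fin.sum_univ_succ, multiCoef, multiExp, Fin.cons_zero, Fin.cons_succ, neg_smul,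
    Finset.sum_neg_distrib]
  simp only [multiKer, multiCoef, multiExp]
  abel

theorem ae_causalConv_multiKer_zero_sub (hα0 : 0 < α) (ha : ∀ i, a i < α) (b : Fin m → ℝ) (μ : ℝ)
    (hv : IntegrableOn v (Ioo 0 T)) :
    ∀ᵐ t ∂volume.restrict (Ioo 0 T),
      causalConv (multiKer α a b 0 α) (fun s => v s - μ • causalConv (multiKer α a b μ α) v s) t =
        causalConv (multiKer α a b μ α) v t := by
  have hker (μ : ℝ) := integrableOn_multiKer (b := b) (μ := μ) hα0 ha hα0 T
  have hconv := integrableOn_causalConv (hker μ) hv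
  have hresolvent : multiKer α a b 0 α =ᵐ[volume.restrict (Ioo 0 T)] fun t =>
      multiKer α a b μ α t + μ * causalConv (multiKer α a b 0 α) (multiKer α a b μ α) t := by
    filter_upwards [ae_multiKer_sub_multiKer (b := b) hα0 ha μ T] with t ht
    rw [← ht, add_sub_cancel]
  filter_upwards [self_mem_ae_restrict measurableSet_Ioo,
    ae_causalConv_assoc (hker 0) (hker μ) hv, ae_causalConvExistsAt (hker 0) hv,
    ae_causalConvExistsAt (hker μ) hv, ae_causalConvExistsAt (hker 0) (hconv.smul μ),
    ae_causalConvExistsAt ((integrableOn_causalConv (hker 0) (hker μ)).const_mul μ) hv]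
    with t ht hassoc hexists₀ hexists hexists_smul hexists_mul
  rw [causalConv_sub_right (w := fun s => μ • causalConv (multiKer α a b μ α) v s)
      hexists₀ hexists_smul, causalConv_smul_right, ← hassoc,
    causalConv_congr hresolvent .rfl ht.2.le, causalConv_add_left hexists hexists_mul,
    causalConv_const_mul_left, add_sub_cancel_right]

end Caputo

/-! ### The mode-wise estimates -/

section Estimates

variable {X : Type*} [NormedAddCommGroup X] [NormedSpace ℝ X] {m : ℕ} {α T : ℝ} {a b : Fin m → ℝ}

theorem lintegral_enorm_smul_causalConv_multiKer_sq_le {μ : ℝ} {v : ℝ → X} (hα0 : 0 < α)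
    (hα1 : α ≤ 1) (ha0 : ∀ i, 0 ≤ a i) (ha : ∀ i, a i < α) (hb : ∀ i, 0 ≤ b i) (hμ : 0 ≤ μ)
    (hv : AEStronglyMeasurable v (volume.restrict (Ioo 0 T))) :
    ∫⁻ t in Ioo 0 T, ‖μ • causalConv (multiKer α a b μ α) v t‖ₑ ^ 2 ≤
      ∫⁻ t in Ioo 0 T, ‖v t‖ₑ ^ 2 := by
  have hker : IntegrableOn (fun t => μ * multiKer α a b μ α t) (Ioo 0 T) :=
    (integrableOn_multiKer hα0 ha hα0 T).const_mul μ
  have hnorm : ∫ t in Ioo 0 T, ‖μ * multiKer α a b μ α t‖ = μ * ∫ t in Ioo 0 T,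
      multiKer α a b μ α t := by
    rw [← integral_const_mul]
    exact setIntegral_congr_fun measurableSet_Ioo fun t ht => Real.norm_of_nonneg
      (mul_nonneg hμ (multiKer_pos hα0 hα1 ha0 ha hb hμ ht.1).le)
  have hone : ∫⁻ t in Ioo 0 T, ‖μ * multiKer α a b μ α t‖ₑ ≤ 1 := by
    rw [← ofReal_integral_norm_eq_lintegral_enorm hker, hnorm]
    exact ENNReal.ofReal_le_one.2 (mul_setIntegral_multiKer_le_one hα0 hα1 ha0 ha hb hμ T)
  simp only [← causalConv_const_mul_left]
  exact (lintegral_enorm_causalConv_sq_le hker.1 hv).trans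
    (mul_le_of_le_one_left' (pow_le_one' hone 2))

theorem lintegral_enorm_sub_sq_le {E Y : Type*} [NormedAddCommGroup E] [MeasurableSpace Y]
    {ν : Measure Y} {v w : Y → E} (hv : AEStronglyMeasurable v ν)
    (hwv : ∫⁻ y, ‖w y‖ₑ ^ 2 ∂ν ≤ ∫⁻ y, ‖v y‖ₑ ^ 2 ∂ν) :
    ∫⁻ y, ‖v y - w y‖ₑ ^ 2 ∂ν ≤ 4 * ∫⁻ y, ‖v y‖ₑ ^ 2 ∂ν := by
  have hpoint (y : Y) : ‖v y - w y‖ₑ ^ 2 ≤ 2 * (‖v y‖ₑ ^ 2 + ‖w y‖ₑ ^ 2) := by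
    have hconvex := ENNReal.rpow_add_le_mul_rpow_add_rpow ‖v y‖ₑ ‖w y‖ₑ one_le_two
    norm_num at hconvex
    exact (pow_le_pow_left' enorm_sub_le 2).trans hconvex
  calc ∫⁻ y, ‖v y - w y‖ₑ ^ 2 ∂ν ≤ ∫⁻ y, 2 * (‖v y‖ₑ ^ 2 + ‖w y‖ₑ ^ 2) ∂ν := lintegral_mono hpoint
    _ = 2 * (∫⁻ y, ‖v y‖ₑ ^ 2 ∂ν + ∫⁻ y, ‖w y‖ₑ ^ 2 ∂ν) := by
        rw [lintegral_const_mul' _ _ (by norm_num), lintegral_add_left' (hv.enorm.pow_const 2)]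
    _ ≤ 2 * (∫⁻ y, ‖v y‖ₑ ^ 2 ∂ν + ∫⁻ y, ‖v y‖ₑ ^ 2 ∂ν) := by gcongr
    _ = 4 * ∫⁻ y, ‖v y‖ₑ ^ 2 ∂ν := by
        rw [← two_mul, ← mul_assoc]
        norm_num

/-- The coefficients of the solution with right-hand side `∑ⱼ cⱼ φⱼ`. -/
def solCoef (lam : ℕ → ℝ) (α : ℝ) (a b : Fin m → ℝ) (c : ℝ → ℕ → ℝ) (t : ℝ) (j : ℕ) : ℝ :=
  causalConv (multiKer α a b (lam j) α) (fun s => c s j) t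

/-- The coefficients of `P(∂ₜ)u = f + Δu` for the solution `u` with right-hand side
`f = ∑ⱼ cⱼ φⱼ`. -/
def derivCoef (lam : ℕ → ℝ) (α : ℝ) (a b : Fin m → ℝ) (c : ℝ → ℕ → ℝ) (t : ℝ) (j : ℕ) : ℝ :=
  c t j - lam j * solCoef lam α a b c t j

variable {lam : ℕ → ℝ} {c : ℝ → ℕ → ℝ} {q : ℝ}

theorem integrableOn_solCoef (hα0 : 0 < α) (ha : ∀ i, a i < α)
    (hc : ∀ j, IntegrableOn (fun t => c t j) (Ioo 0 T)) (j : ℕ) :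
    IntegrableOn (fun t => solCoef lam α a b c t j) (Ioo 0 T) :=
  integrableOn_causalConv (integrableOn_multiKer hα0 ha hα0 T) (hc j)

theorem integrableOn_derivCoef (hα0 : 0 < α) (ha : ∀ i, a i < α)
    (hc : ∀ j, IntegrableOn (fun t => c t j) (Ioo 0 T)) (j : ℕ) :
    IntegrableOn (fun t => derivCoef lam α a b c t j) (Ioo 0 T) :=
  (hc j).sub ((integrableOn_solCoef hα0 ha hc j).const_mul (lam j))

theorem coefSq_solCoef_le (hα0 : 0 < α) (hα1 : α ≤ 1) (ha0 : ∀ i, 0 ≤ a i) (ha : ∀ i, a i < α)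
    (hb : ∀ i, 0 ≤ b i) (hlam : ∀ j, 0 < lam j)
    (hc : ∀ j, IntegrableOn (fun t => c t j) (Ioo 0 T)) :
    coefSq lam (q + 2) T (solCoef lam α a b c) ≤ coefSq lam q T c := by
  rw [coefSq_add_two hlam]
  simpa only [one_mul] using coefSq_le_mul (A := 1)
    (fun j => ((integrableOn_solCoef hα0 ha hc j).const_mul (lam j)).1) (fun j => (hc j).1)
    fun j => by
      rw [one_mul]
      exact lintegral_enorm_smul_causalConv_multiKer_sq_le hα0 hα1 ha0 ha hb (hlam j).le (hc j).1

theorem coefSq_derivCoef_le (hα0 : 0 < α) (hα1 : α ≤ 1) (ha0 : ∀ i, 0 ≤ a i) (ha : ∀ i, a i < α)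
    (hb : ∀ i, 0 ≤ b i) (hlam : ∀ j, 0 ≤ lam j)
    (hc : ∀ j, IntegrableOn (fun t => c t j) (Ioo 0 T)) :
    coefSq lam q T (derivCoef lam α a b c) ≤ 4 * coefSq lam q T c :=
  coefSq_le_mul (fun j => (integrableOn_derivCoef hα0 ha hc j).1) (fun j => (hc j).1) fun j =>
    lintegral_enorm_sub_sq_le (hc j).1
      (lintegral_enorm_smul_causalConv_multiKer_sq_le hα0 hα1 ha0 ha hb (hlam j) (hc j).1)

theorem MemL2Coef.derivCoef (hcL2 : MemL2Coef lam q T c) (hα0 : 0 < α) (hα1 : α ≤ 1)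
    (ha0 : ∀ i, 0 ≤ a i) (ha : ∀ i, a i < α) (hb : ∀ i, 0 ≤ b i) (hlam : ∀ j, 0 ≤ lam j)
    (hc : ∀ j, IntegrableOn (fun t => c t j) (Ioo 0 T)) :
    MemL2Coef lam q T (derivCoef lam α a b c) where
  aestronglyMeasurable j := (integrableOn_derivCoef hα0 ha hc j).1
  coefSq_lt_top := (coefSq_derivCoef_le hα0 hα1 ha0 ha hb hlam hc).trans_lt
    (ENNReal.mul_lt_top (by norm_num) hcL2.coefSq_lt_top)

end Estimates

/-! ### The solution representation -/

section Solution

variable {m : ℕ} {α t T : ℝ} {a b : Fin m → ℝ} {lam : ℕ → ℝ}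

theorem aestronglyMeasurable_kernelE_sub (hα0 : 0 < α) (ha : ∀ i, a i < α) (μ t : ℝ) :
    AEStronglyMeasurable (fun s => kernelE α a b μ (t - s)) (volume.restrict (Ioo 0 t)) := by
  have hcont : ContinuousOn (fun s => multiKer α a b μ α (t - s)) (Ioo 0 t) :=
    (continuousOn_multiKer hα0 ha hα0).comp (by fun_prop) fun s hs => sub_pos.2 hs.2
  exact (hcont.congr fun s hs => kernelE_eq_multiKer α a b μ (sub_pos.2 hs.2)).aestronglyMeasurable
    measurableSet_Ioo

theorem ae_abs_kernelE_sub_le (hα0 : 0 < α) (hα1 : α ≤ 1) (ha0 : ∀ i, 0 ≤ a i)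
    (ha : ∀ i, a i < α) (hb : ∀ i, 0 ≤ b i) (hlam : ∀ j, 0 ≤ lam j) (t : ℝ) :
    ∀ᵐ s ∂volume.restrict (Ioo 0 t), ∀ j,
      |kernelE α a b (lam j) (t - s)| ≤ multiKer α a b 0 α (t - s) := by
  filter_upwards [self_mem_ae_restrict measurableSet_Ioo, ae_restrict_comp_sub_left
    (ae_all_iff.2 fun j => ae_multiKer_le_multiKer_zero hα0 hα1 ha0 ha hb (hlam j) t) le_rfl]
    with s hs hle j
  have hts : 0 < t - s := sub_pos.2 hs.2
  rw [kernelE_eq_multiKer _ _ _ _ hts,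
    abs_of_pos (multiKer_pos hα0 hα1 ha0 ha hb (hlam j) hts)]
  exact hle j

theorem setIntegral_kernelE_sub_mul (c : ℝ → ℕ → ℝ) (t : ℝ) (j : ℕ) :
    ∫ s in Ioo 0 t, kernelE α a b (lam j) (t - s) * c s j = solCoef lam α a b c t j :=
  setIntegral_congr_fun measurableSet_Ioo fun s hs => by
    simp only [kernelE_eq_multiKer _ _ _ _ (sub_pos.2 hs.2), smul_eq_mul]

variable {d : ℕ} {Ω : Set (EuclideanSpace ℝ (Fin d))} {φ : ℕ → H10 Ω}

namespace IsDirichletEigensystem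

variable (hφ : IsDirichletEigensystem Ω lam φ) {f : ℝ → Hneg1 Ω}
include hφ

theorem ae_isHneg1Coef_kernelE_mul (hα0 : 0 < α) (hα1 : α ≤ 1) (ha0 : ∀ i, 0 ≤ a i)
    (ha : ∀ i, a i < α) (hb : ∀ i, 0 ≤ b i)
    (hf : ∀ᵐ s ∂volume.restrict (Ioo 0 t), IsHneg1Coef lam fun j => f s (φ j)) :
    ∀ᵐ s ∂volume.restrict (Ioo 0 t),
      IsHneg1Coef lam fun j => kernelE α a b (lam j) (t - s) * f s (φ j) := by
  filter_upwards [hf, ae_abs_kernelE_sub_le hα0 hα1 ha0 ha hb hφ.eigenvalue_nonneg t] with s hs hle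
  refine hφ.isHneg1Coef_of_abs_le (A := multiKer α a b 0 α (t - s)) hs fun j => ?_
  rw [abs_mul]
  exact mul_le_mul_of_nonneg_right (hle j) (abs_nonneg _)

theorem integrableOn_Ebar (hα0 : 0 < α) (hα1 : α ≤ 1) (ha0 : ∀ i, 0 ≤ a i) (ha : ∀ i, a i < α)
    (hb : ∀ i, 0 ≤ b i)
    (hmeas : ∀ j, AEStronglyMeasurable (fun s => f s (φ j)) (volume.restrict (Ioo 0 t)))
    (hf : ∀ᵐ s ∂volume.restrict (Ioo 0 t), IsHneg1Coef lam fun j => f s (φ j))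
    (hconv : CausalConvExistsAt (multiKer α a b 0 α) (fun s => synth φ fun j => f s (φ j)) t) :
    IntegrableOn (fun s => Ebar lam φ α a b (t - s) (f s)) (Ioo 0 t) := by
  refine Integrable.mono hconv (hφ.aestronglyMeasurable_synth
    (fun j => (aestronglyMeasurable_kernelE_sub hα0 ha (lam j) t).mul (hmeas j))
    (hφ.ae_isHneg1Coef_kernelE_mul hα0 hα1 ha0 ha hb hf)) ?_
  filter_upwards [self_mem_ae_restrict measurableSet_Ioo, hf,
    ae_abs_kernelE_sub_le hα0 hα1 ha0 ha hb hφ.eigenvalue_nonneg t] with s hs hfs hle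
  have hK : 0 ≤ multiKer α a b 0 α (t - s) :=
    (multiKer_pos hα0 hα1 ha0 ha hb le_rfl (sub_pos.2 hs.2)).le
  rw [norm_smul, Real.norm_of_nonneg hK]
  refine hφ.norm_synth_le hK hfs fun j => ?_
  rw [abs_mul]
  exact mul_le_mul_of_nonneg_right (hle j) (abs_nonneg _)

theorem solRep_apply
    (hcoef : ∀ᵐ s ∂volume.restrict (Ioo 0 t),
      IsHneg1Coef lam fun j => kernelE α a b (lam j) (t - s) * f s (φ j))
    (hint : IntegrableOn (fun s => Ebar lam φ α a b (t - s) (f s)) (Ioo 0 t)) (j : ℕ) :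
    solRep lam φ α a b f t (φ j) = solCoef lam α a b (fun s j => f s (φ j)) t j :=
  (hφ.integral_synth_apply hcoef hint j).trans
    (setIntegral_kernelE_sub_mul (fun s j => f s (φ j)) t j)

variable {q M : ℝ}

theorem ae_Ebar_converges (hα0 : 0 < α) (hα1 : α ≤ 1) (ha0 : ∀ i, 0 ≤ a i) (ha : ∀ i, a i < α)
    (hb : ∀ i, 0 ≤ b i) (hM : ∀ j, (1 + lam j)⁻¹ ≤ M * lam j ^ q) (hf : MemL2DotH lam φ q T f) :
    ∀ᵐ t ∂volume.restrict (Ioo 0 T),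
      (∀ᵐ s ∂volume.restrict (Ioo 0 t),
        IsHneg1Coef lam fun j => kernelE α a b (lam j) (t - s) * f s (φ j)) ∧
      IntegrableOn (fun s => Ebar lam φ α a b (t - s) (f s)) (Ioo 0 t) := by
  filter_upwards [self_mem_ae_restrict measurableSet_Ioo, ae_causalConvExistsAt
    (integrableOn_multiKer (b := b) (μ := 0) hα0 ha hα0 T)
    (hφ.integrableOn_synth hM hf.memL2Coef)] with t ht hconv
  have hft := hf.memL2Coef.mono ht.2.le
  have hcoef := hφ.ae_isHneg1Coef hM hft
  exact ⟨hφ.ae_isHneg1Coef_kernelE_mul hα0 hα1 ha0 ha hb hcoef,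
    hφ.integrableOn_Ebar hα0 hα1 ha0 ha hb hft.aestronglyMeasurable hcoef hconv⟩

theorem integrableOn_coef (hM : ∀ j, (1 + lam j)⁻¹ ≤ M * lam j ^ q)
    (hf : MemL2DotH lam φ q T f) (j : ℕ) : IntegrableOn (fun t => f t (φ j)) (Ioo 0 T) :=
  hφ.integrable_coef (hφ.ae_isHneg1Coef hM hf.memL2Coef)
    (hφ.integrableOn_synth hM hf.memL2Coef) j

theorem memL2Coef_derivCoef (hα0 : 0 < α) (hα1 : α ≤ 1) (ha0 : ∀ i, 0 ≤ a i)
    (ha : ∀ i, a i < α) (hb : ∀ i, 0 ≤ b i) (hM : ∀ j, (1 + lam j)⁻¹ ≤ M * lam j ^ q)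
    (hf : MemL2DotH lam φ q T f) :
    MemL2Coef lam q T (derivCoef lam α a b fun t j => f t (φ j)) :=
  hf.memL2Coef.derivCoef hα0 hα1 ha0 ha hb hφ.eigenvalue_nonneg (hφ.integrableOn_coef hM hf)

theorem solRep_ae_eq_causalConv (hα0 : 0 < α) (hα1 : α ≤ 1) (ha0 : ∀ i, 0 ≤ a i)
    (ha : ∀ i, a i < α) (hb : ∀ i, 0 ≤ b i) (hM : ∀ j, (1 + lam j)⁻¹ ≤ M * lam j ^ q)
    (hf : MemL2DotH lam φ q T f) :
    solRep lam φ α a b f =ᵐ[volume.restrict (Ioo 0 T)] causalConv (multiKer α a b 0 α)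
      fun s => synth φ (derivCoef lam α a b (fun t j => f t (φ j)) s) := by
  have hderiv := hφ.memL2Coef_derivCoef hα0 hα1 ha0 ha hb hM hf
  filter_upwards [self_mem_ae_restrict measurableSet_Ioo,
    hφ.ae_Ebar_converges hα0 hα1 ha0 ha hb hM hf,
    ae_causalConvExistsAt (integrableOn_multiKer (b := b) (μ := 0) hα0 ha hα0 T)
      (hφ.integrableOn_synth hM hderiv),
    ae_all_iff.2 fun j => ae_causalConv_multiKer_zero_sub hα0 ha b (lam j)
      (hφ.integrableOn_coef hM hf j)] with t ht hEbar hconv hmode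
  have hcoef : ∀ᵐ s ∂volume.restrict (Ioo 0 t), IsHneg1Coef lam fun j =>
      multiKer α a b 0 α (t - s) * derivCoef lam α a b (fun t j => f t (φ j)) s j := by
    filter_upwards [hφ.ae_isHneg1Coef hM (hderiv.mono ht.2.le)] with s hs
    exact hφ.isHneg1Coef_of_abs_le hs fun j => (abs_mul _ _).le
  simp only [CausalConvExistsAt, smul_synth] at hconv
  simp only [causalConv, smul_synth]
  exact hφ.integral_synth_eq_integral_synth hEbar.1 hEbar.2 hcoef hconv fun j =>
    (setIntegral_kernelE_sub_mul (fun s j => f s (φ j)) t j).trans (hmode j).symm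

theorem hasMultiTermDeriv_solRep (hα0 : 0 < α) (hα1 : α < 1) (ha0 : ∀ i, 0 ≤ a i)
    (ha : ∀ i, a i < α) (hb : ∀ i, 0 ≤ b i) (hM : ∀ j, (1 + lam j)⁻¹ ≤ M * lam j ^ q)
    (hf : MemL2DotH lam φ q T f) :
    HasMultiTermDeriv α a b T (solRep lam φ α a b f)
      fun t => synth φ (derivCoef lam α a b (fun t j => f t (φ j)) t) := by
  have hinverse := hasMultiTermDeriv_causalConv_multiKer hα0 hα1 ha b 0
    (hφ.integrableOn_synth hM (hφ.memL2Coef_derivCoef hα0 hα1.le ha0 ha hb hM hf))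
  simp only [zero_smul, sub_zero] at hinverse
  exact hinverse.congr (hφ.solRep_ae_eq_causalConv hα0 hα1.le ha0 ha hb hM hf).symm

theorem normL2DotH_solRep_le (hα0 : 0 < α) (hα1 : α ≤ 1) (ha0 : ∀ i, 0 ≤ a i)
    (ha : ∀ i, a i < α) (hb : ∀ i, 0 ≤ b i) (hlam : ∀ j, 0 < lam j)
    (hM : ∀ j, (1 + lam j)⁻¹ ≤ M * lam j ^ q) (hf : MemL2DotH lam φ q T f) :
    normL2DotH lam φ (q + 2) T (solRep lam φ α a b f) ≤ normL2DotH lam φ q T f := by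
  have hcoef : ∀ᵐ t ∂volume.restrict (Ioo 0 T), ∀ j,
      solRep lam φ α a b f t (φ j) = solCoef lam α a b (fun t j => f t (φ j)) t j :=
    (hφ.ae_Ebar_converges hα0 hα1 ha0 ha hb hM hf).mono fun _ ht => hφ.solRep_apply ht.1 ht.2
  simpa only [one_mul] using normL2DotH_le_mul (A := 1) hcoef (by
    simpa only [one_pow, one_mul] using
      coefSq_solCoef_le hα0 hα1 ha0 ha hb hlam (hφ.integrableOn_coef hM hf))

theorem normL2DotH_synth_derivCoef_le (hα0 : 0 < α) (hα1 : α ≤ 1) (ha0 : ∀ i, 0 ≤ a i)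
    (ha : ∀ i, a i < α) (hb : ∀ i, 0 ≤ b i) (hM : ∀ j, (1 + lam j)⁻¹ ≤ M * lam j ^ q)
    (hf : MemL2DotH lam φ q T f) :
    normL2DotH lam φ q T (fun t => synth φ (derivCoef lam α a b (fun t j => f t (φ j)) t)) ≤
      2 * normL2DotH lam φ q T f :=
  normL2DotH_le_mul
    (hφ.ae_synth_apply hM (hφ.memL2Coef_derivCoef hα0 hα1 ha0 ha hb hM hf))
    ((coefSq_derivCoef_le hα0 hα1 ha0 ha hb hφ.eigenvalue_nonneg
      (hφ.integrableOn_coef hM hf)).trans_eq (by norm_num))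

end IsDirichletEigensystem

end Solution

end

end FracDiffusion

theorem theorem2p3_general {d m : ℕ} (hd : 1 ≤ d) {Ω : Set (EuclideanSpace ℝ (Fin d))}
    (hΩ : Bornology.IsBounded Ω) {lam : ℕ → ℝ} {φ : ℕ → H10 Ω}
    (hφ : IsDirichletEigensystem Ω lam φ) {α : ℝ} {a b : Fin m → ℝ} (hα0 : 0 < α) (hα1 : α < 1)
    (ha0 : ∀ i, 0 ≤ a i) (ha : ∀ i, a i < α) (hb : ∀ i, 0 ≤ b i) {T q : ℝ} (hq : -1 ≤ q)
    {f : ℝ → Hneg1 Ω} (hf : MemL2DotH lam φ q T f) :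
    (∀ᵐ t ∂(volume.restrict (Ioo 0 T)),
      (∀ᵐ s ∂(volume.restrict (Ioo 0 t)), Summable (EbarTerm lam φ α a b (t - s) (f s))) ∧
      IntegrableOn (fun s => Ebar lam φ α a b (t - s) (f s)) (Ioo 0 t)) ∧
    MemL2DotH lam φ (q + 2) T (solRep lam φ α a b f) ∧
    ∃ g : ℝ → Hneg1 Ω,
      HasMultiTermDeriv α a b T (solRep lam φ α a b f) g ∧
      MemL2DotH lam φ q T g ∧
      ∀ t ≤ T,
        normL2DotH lam φ (q + 2) t (solRep lam φ α a b f) + normL2DotH lam φ q t g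
          ≤ 3 * normL2DotH lam φ q t f := by
  obtain ⟨c₀, hc₀, hlam⟩ := hφ.exists_le_eigenvalue hd hΩ
  have hM := fun j => inv_one_add_le_mul_rpow hc₀ (hlam j) hq
  have hderiv := hφ.hasMultiTermDeriv_solRep hα0 hα1 ha0 ha hb hM hf
  have hu := fun t (ht : t ≤ T) => hφ.normL2DotH_solRep_le hα0 hα1.le ha0 ha hb
    (fun j => hc₀.trans_le (hlam j)) hM (hf.mono ht)
  have hg := fun t (ht : t ≤ T) =>
    hφ.normL2DotH_synth_derivCoef_le hα0 hα1.le ha0 ha hb hM (hf.mono ht)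
  refine ⟨?_, ⟨hderiv.aestronglyMeasurable, (hu T le_rfl).trans_lt hf.2⟩, _, hderiv,
    ⟨(hφ.integrableOn_synth hM (hφ.memL2Coef_derivCoef hα0 hα1.le ha0 ha hb hM hf)).1,
      (hg T le_rfl).trans_lt (ENNReal.mul_lt_top (by norm_num) hf.2)⟩, fun t ht => ?_⟩
  · filter_upwards [hφ.ae_Ebar_converges hα0 hα1.le ha0 ha hb hM hf] with t ht
    exact ⟨ht.1.mono fun s => hφ.summable_synth, ht.2⟩
  · calc _ ≤ normL2DotH lam φ q t f + 2 * normL2DotH lam φ q t f := add_le_add (hu t ht) (hg t ht)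
      _ = 3 * normL2DotH lam φ q t f := by ring

theorem theorem2p3 {d m : ℕ} (hd : 1 ≤ d) (hd3 : d ≤ 3)
    (Ω : Set (EuclideanSpace ℝ (Fin d))) (hΩ : IsConvexPolytopeDomain Ω)
    (lam : ℕ → ℝ) (φ : ℕ → H10 Ω) (hφ : IsDirichletEigensystem Ω lam φ)
    (α : ℝ) (a b : Fin m → ℝ) (hα0 : 0 < α) (hα1 : α < 1)
    (ha : ∀ i, 0 < a i ∧ a i < α) (hb : ∀ i, 0 < b i)
    (T : ℝ) (hT : 0 < T) (q : ℝ) (hq : -1 < q) (hq1 : q ≤ 1) :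
    ∃ C : ℝ≥0, ∀ f : ℝ → Hneg1 Ω, MemL2DotH lam φ q T f →
      -- the series and the integral in the representation converge
      (∀ᵐ t ∂(volume.restrict (Ioo 0 T)),
        (∀ᵐ s ∂(volume.restrict (Ioo 0 t)),
          Summable (EbarTerm lam φ α a b (t - s) (f s))) ∧
        IntegrableOn (fun s => Ebar lam φ α a b (t - s) (f s)) (Ioo 0 t)) ∧
      MemL2DotH lam φ (q + 2) T (solRep lam φ α a b f) ∧
      ∃ g : ℝ → Hneg1 Ω,
        HasMultiTermDeriv α a b T (solRep lam φ α a b f) g ∧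
        MemL2DotH lam φ q T g ∧
        ∀ t ∈ Ioc 0 T,
          normL2DotH lam φ (q + 2) t (solRep lam φ α a b f) + normL2DotH lam φ q t g
            ≤ C * normL2DotH lam φ q t f :=
  ⟨3, fun _ hf =>
    let ⟨hEbar, hu, g, hderiv, hg, hle⟩ := theorem2p3_general hd hΩ.isBounded hφ hα0 hα1
      (fun i => (ha i).1.le) (fun i => (ha i).2) (fun i => (hb i).le) hq.le hf
    ⟨hEbar, hu, g, hderiv, hg, fun t ht => hle t ht.2⟩⟩
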